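/- Let $p$ be a prime, and put $\mathbf{p}=4$ if $p=2$ and $\mathbf{p}=p$ if $p$ is odd. Let $M$ be a Lie $\mathbb{Z}_p$-algebra without $\mathbb{Z}_p$-torsion such that $\bigcap_i p^iM=0$ and $M$ is complete in the topology induced by the filtration $(p^iM)_i$. Let $H(x_1,x_2)=\log(e^{x_1}e^{x_2})$ be the Baker-Campbell-Hausdorff series, a formal power series over $\mathbb{Q}$ in two non-commuting variables, and let $H_n(x_1,x_2)$ be its homogeneous component of degree $n$. Each $H_n$ is (uniquely) a Lie word in $x_1,x_2$ with rational coefficients, that is, the image of exactly one element of the free Lie $\mathbb{Q}$-algebra on $x_1,x_2$; hence for $a,b\in M$ it has a value $H_n(a,b)\in \mathbb{Q}\otimes_{\mathbb{Z}} M\supseteq M$. Then: 1. if $a,b\in\mathbf{p}M$, then $H_n(a,b)\in\mathbf{p}M$ for all $n$, and $\lim_{n\to\infty}H_n(a,b)=0$; moreover the series $H(a,b)=\sum_{n\ge1}H_n(a,b)$ converges in $M$ to an element of $\mathbf{p}M$; 2. $\mathbf{p}M$ with the operation $(a,b)\mapsto H(a,b)$ is a group. -/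

import Mathlib

open scoped TensorProduct Pointwise

noncomputable section

namespace BCHGroup

attribute [local instance 100] LieRing.ofAssociativeRing

/-- The number written as a bold `p`: it is `4` if `p = 2`, and `p` if `p` is odd. -/
def boldP (p : ℕ) : ℕ := if p = 2 then 4 else p

/-- The associative algebra `ℚ⟨x₁, x₂⟩` of polynomials in two non-commuting variables. -/
abbrev Assoc2 : Type := FreeAlgebra ℚ (Fin 2)

/-- The variables `x₁` (index `0`) and `x₂` (index `1`). -/
def var (i : Fin 2) : Assoc2 := FreeAlgebra.ι ℚ i

/-- Formal power series in the two non-commuting variables are handled through their homogeneous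
components: the series `f = ∑ fₙ`, with `fₙ` homogeneous of degree `n`, is written as the power
series `∑ fₙ tⁿ` in a central variable `t` that records the degree.
For `a = var i`, this is the exponential series `e^a = ∑ aⁿ / n!`. -/
def expSeries (a : Assoc2) : PowerSeries Assoc2 :=
  PowerSeries.mk fun n => ((n.factorial : ℚ)⁻¹) • a ^ n

/-- The degree `n` component of `log u = ∑_{k ≥ 1} (-1)^(k+1) (u - 1)^k / k`, for a series `u` with
constant term `1`. Then `(u - 1)^k` has no component of degree `n` when `k > n`, so that only the
terms with `1 ≤ k ≤ n` contribute. -/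
def logComponent (u : PowerSeries Assoc2) (n : ℕ) : Assoc2 :=
  ∑ k ∈ Finset.Icc 1 n, ((-1 : ℚ) ^ (k + 1) / (k : ℚ)) • PowerSeries.coeff n ((u - 1) ^ k)

/-- The homogeneous component `Hₙ(x₁, x₂)` of degree `n` of the Baker-Campbell-Hausdorff series
`H(x₁, x₂) = log (e^{x₁} e^{x₂})`, as a non-commutative polynomial. -/
def bchComponent (n : ℕ) : Assoc2 :=
  logComponent (expSeries (var 0) * expSeries (var 1)) n

/-- Lie words in `x₁` and `x₂` with rational coefficients. -/
abbrev LieWord : Type := FreeLieAlgebra ℚ (Fin 2)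

/-- A Lie word as a non-commutative polynomial, the bracket being `[u, v] = u v - v u`. -/
def LieWord.toAssoc (w : LieWord) : Assoc2 :=
  FreeLieAlgebra.lift ℚ var w

/-- The value `w(a, b)` of a Lie word at two elements of a Lie ring `M`. Since `w` has rational
coefficients, the value lies in `ℚ ⊗ M`, which contains `M` when `M` is torsion-free. -/
def LieWord.value {M : Type*} [LieRing M] (w : LieWord) (a b : M) : ℚ ⊗[ℤ] M :=
  FreeLieAlgebra.lift ℚ (![(1 : ℚ) ⊗ₜ[ℤ] a, (1 : ℚ) ⊗ₜ[ℤ] b] : Fin 2 → ℚ ⊗[ℤ] M) w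

/-- The submodule `𝐩 M` of a `ℤ_p`-module `M`. -/
abbrev boldPMul (p : ℕ) [Fact p.Prime] (M : Type*) [AddCommGroup M] [Module ℤ_[p] M] :
    Submodule ℤ_[p] M :=
  (boldP p : ℤ_[p]) • (⊤ : Submodule ℤ_[p] M)

/-- The topology on `M` that is induced by the filtration `pⁱ M`. -/
abbrev padicTopology (p : ℕ) [Fact p.Prime] (M : Type*) [AddCommGroup M] [Module ℤ_[p] M] :
    TopologicalSpace M :=
  (Ideal.span {(p : ℤ_[p])}).adicModuleTopology M

end BCHGroup

end

/-! ### Exponential and logarithm of nilpotent elements -/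

namespace BCHGroup

open Finset

/-! Everything rests on an explicit Lie form of `Hₙ` whose denominators can be bounded.

Lie form. Working with a central nilpotent `τ` turns `log(e^x e^y)` into a finite sum characterised
by its exponential, and `exp` is injective on multiples of `τ`. Hence `Hₙ` is primitive for the
comultiplication (`freeComul_bchComponent`). Convolving the right-normed bracketing `D` with the
identity multiplies words of length `n` by `n`, so primitivity gives `D(Hₙ) = n Hₙ`, and `Hₙ =
D(Hₙ)/n` is a Lie word. Uniqueness is the embedding of the free Lie algebra in the free associative
one. It follows from the same bracketing: in `L[t]` the derivation `t d/dt` shows that the degree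
`N` part of a Lie word is determined by its associative image (`coeffPoly_lift_scaled_eq_zero`).

Estimate. By Legendre's formula the coefficients of `Hₙ` have valuation at least `-(n-1)/(p-1)`, and
the factor `1/n` costs a further `v_p(n) ≤ (n-1)/(p-1)`. Brackets of `n` elements of `p^e Λ` lie in
`p^(en) Λ`. With `p^e = 𝐩` the gain covers the loss with `e` to spare, and by an amount that tends
to infinity with `n`. This gives integrality and convergence.

Group law. Formal associativity comes from `exp`, and holds for partial sums in degrees up to the
cutoff. The discrepancy in higher degrees is small by the estimate applied to `Λ[t]`, and continuity
of the operation comes from the estimate applied to a lattice in `L × L`. Commuting elements simply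
add, so `0` is the identity and `-a` the inverse of `a`. -/

theorem exp_subst_log :
    (PowerSeries.exp ℚ).subst (PowerSeries.log ℚ) = 1 + PowerSeries.X := by
  set g := (PowerSeries.exp ℚ).subst (PowerSeries.log ℚ) with hg
  set E := PowerSeries.derivative ℚ (PowerSeries.log ℚ) with hE
  have hE1 : E * (1 + PowerSeries.X) = 1 := by
    rw [hE, PowerSeries.deriv_log]
    ext n
    rw [mul_add, mul_one, map_add]
    cases n with
    | zero => simp
    | succ n =>
      rw [PowerSeries.coeff_succ_mul_X, PowerSeries.coeff_mk, PowerSeries.coeff_mk,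
        PowerSeries.coeff_one]
      simp [pow_succ]
  have hg' : PowerSeries.derivative ℚ g = g * E := by
    rw [hg, PowerSeries.derivative_subst PowerSeries.HasSubst.log, PowerSeries.derivative_exp]
  have hE' : PowerSeries.derivative ℚ E = - (E * E) := by
    have h := congrArg (PowerSeries.derivative ℚ) hE1
    rw [Derivation.leibniz, map_add, PowerSeries.derivative_one, PowerSeries.derivative_X,
      smul_eq_mul, smul_eq_mul] at h
    linear_combination E * h - (PowerSeries.derivative ℚ E) * hE1
  -- The derivative of `g * E` is `g E² - g E² = 0`, and its constant term is `1`.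
  have hgE : g * E = 1 := by
    apply PowerSeries.derivative.ext
    · rw [Derivation.leibniz, hg', hE', PowerSeries.derivative_one, smul_eq_mul, smul_eq_mul]
      ring
    · have h0 : PowerSeries.constantCoeff g = 1 := by
        have := PowerSeries.constantCoeff_subst (PowerSeries.HasSubst.log (A := ℚ))
          (PowerSeries.exp ℚ)
        rw [finsum_eq_single _ 0] at this
        · exact this.trans (by simp)
        · intro n hn
          change _ • PowerSeries.constantCoeff _ = 0
          simp [hn]
      have h1 : PowerSeries.constantCoeff E = 1 := by
        rw [hE, PowerSeries.deriv_log]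
        simp
      rw [map_mul, h0, h1]; simp
  linear_combination (1 + PowerSeries.X) * hgE - g * hE1

open Polynomial in
/-- The logarithm series `log (1 + X)` up to degree `R`. -/
noncomputable def logPoly (R : ℕ) : ℚ[X] :=
  ∑ k ∈ Icc 1 R, ((-1 : ℚ) ^ (k + 1) / (k : ℚ)) • X ^ k

open Polynomial in
-- Truncating the logarithm changes its powers only in degrees above `R`, and powers with exponent
-- above `R` have no terms of degree at most `R`.
theorem X_pow_dvd_exp_logPoly (R : ℕ) :
    (X : ℚ[X]) ^ (R + 1) ∣
      (∑ k ∈ range (R + 1), ((k.factorial : ℚ)⁻¹) • logPoly R ^ k) - (1 + X) := by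
  have hlog : (PowerSeries.X : PowerSeries ℚ) ^ (R + 1) ∣
      PowerSeries.log ℚ - (logPoly R : PowerSeries ℚ) := by
    rw [PowerSeries.X_pow_dvd_iff]
    intro m hm
    rw [map_sub, PowerSeries.coeff_log, Polynomial.coeff_coe, logPoly, Polynomial.finsetSum_coeff]
    simp only [Polynomial.coeff_smul, Polynomial.coeff_X_pow, smul_eq_mul, mul_ite, mul_one,
      mul_zero, Finset.sum_ite_eq, mem_Icc]
    rcases Nat.eq_zero_or_pos m with h | h
    · simp [h]
    · rw [if_neg h.ne', if_pos ⟨h, by omega⟩]; simp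
  rw [Polynomial.X_pow_dvd_iff]
  intro m hm
  have h1 := congrArg (PowerSeries.coeff m) exp_subst_log
  rw [PowerSeries.coeff_subst' PowerSeries.HasSubst.log,
    finsum_eq_sum_of_support_subset (s := range (R + 1))] at h1
  · rw [Polynomial.coeff_sub, ← Polynomial.coeff_coe (1 + X), Polynomial.coe_add,
      Polynomial.coe_one, Polynomial.coe_X, ← h1, Polynomial.finsetSum_coeff,
      ← Finset.sum_sub_distrib]
    apply Finset.sum_eq_zero
    intro k _
    have h2 : (PowerSeries.X : PowerSeries ℚ) ^ (R + 1) ∣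
        PowerSeries.log ℚ ^ k - (logPoly R : PowerSeries ℚ) ^ k :=
      hlog.trans (sub_dvd_pow_sub_pow _ _ _)
    rw [PowerSeries.X_pow_dvd_iff] at h2
    have h3 := h2 m hm
    rw [map_sub, sub_eq_zero, ← Polynomial.coe_pow, Polynomial.coeff_coe] at h3
    rw [h3]
    simp [PowerSeries.coeff_exp]
  · intro k hk
    by_contra hk2
    apply hk
    simp only [coe_range, Set.mem_Iio, not_lt] at hk2
    have h4 : (PowerSeries.X : PowerSeries ℚ) ^ k ∣ PowerSeries.log ℚ ^ k :=
      pow_dvd_pow_of_dvd (PowerSeries.X_dvd_iff.2 (by simp)) k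
    rw [PowerSeries.X_pow_dvd_iff] at h4
    simp [h4 m (by omega)]

section Nilpotent

variable {B : Type*} [Ring B] [Algebra ℚ B]

theorem exp_log_of_pow_eq_zero {z : B} {R : ℕ} (hz : z ^ (R + 1) = 0) :
    IsNilpotent.exp (∑ k ∈ Icc 1 R, ((-1 : ℚ) ^ (k + 1) / (k : ℚ)) • z ^ k) = 1 + z := by
  have h1 : Polynomial.aeval z (logPoly R) =
      ∑ k ∈ Icc 1 R, ((-1 : ℚ) ^ (k + 1) / (k : ℚ)) • z ^ k := by
    simp [logPoly]
  have hX : (Polynomial.X : Polynomial ℚ) ∣ logPoly R := by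
    rw [logPoly]
    apply Finset.dvd_sum
    intro k hk
    rw [Polynomial.smul_eq_C_mul]
    apply Dvd.dvd.mul_left
    exact dvd_pow_self _ (by have := (mem_Icc.1 hk).1; omega)
  have h2 : (Polynomial.aeval z (logPoly R)) ^ (R + 1) = 0 := by
    obtain ⟨c, hc⟩ := pow_dvd_pow_of_dvd hX (R + 1)
    rw [← map_pow, hc, map_mul, map_pow, Polynomial.aeval_X, hz, zero_mul]
  rw [← h1, IsNilpotent.exp_eq_sum h2]
  obtain ⟨c, hc⟩ := X_pow_dvd_exp_logPoly R
  have h3 := congrArg (Polynomial.aeval z) hc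
  rw [map_mul, map_pow, Polynomial.aeval_X, hz, zero_mul, map_sub, sub_eq_zero] at h3
  simpa using h3

theorem mul_pow_eq_zero_of_central {B : Type*} [Ring B] {τ : B} (hc : ∀ b, Commute τ b) {R : ℕ}
    (hτ : τ ^ (R + 1) = 0) (a : B) : (τ * a) ^ (R + 1) = 0 := by
  rw [(hc a).mul_pow, hτ, zero_mul]

/-- No commutation of `a` with `b` is needed. If the difference of the arguments is divisible by
`τ^(k+1)`, then the differences of their higher powers are divisible by `τ^(k+2)`. Equality of
exponentials passes this on to the linear term, and the divisibility improves until `τ^(R+1) = 0`.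
-/
theorem exp_injective_of_central {τ : B} (hc : ∀ b, Commute τ b) {R : ℕ}
    (hτ : τ ^ (R + 1) = 0) {a b : B}
    (h : IsNilpotent.exp (τ * a) = IsNilpotent.exp (τ * b)) : τ * a = τ * b := by
  rw [IsNilpotent.exp_eq_sum (mul_pow_eq_zero_of_central hc hτ a),
    IsNilpotent.exp_eq_sum (mul_pow_eq_zero_of_central hc hτ b)] at h
  have key : ∀ k, ∃ c, τ * a - τ * b = τ ^ (k + 1) * c := by
    intro k
    induction k with
    | zero => exact ⟨a - b, by rw [mul_sub, zero_add, pow_one]⟩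
    | succ k ih =>
      obtain ⟨c, hk⟩ := ih
      have hpow : ∀ m, ∃ d, (τ * a) ^ (m + 1) - (τ * b) ^ (m + 1) = τ ^ (k + 1 + m) * d := by
        intro m
        induction m with
        | zero => exact ⟨c, by simpa using hk⟩
        | succ m ih =>
          obtain ⟨d, hd⟩ := ih
          refine ⟨a * d + c * b ^ (m + 1), ?_⟩
          have e1 : (τ * a) ^ (m + 1 + 1) - (τ * b) ^ (m + 1 + 1) =
              (τ * a) * ((τ * a) ^ (m + 1) - (τ * b) ^ (m + 1)) +
                (τ * a - τ * b) * (τ * b) ^ (m + 1) := by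
            rw [pow_succ' _ (m + 1), pow_succ' _ (m + 1)]; noncomm_ring
          rw [e1, hd, hk, (hc b).mul_pow, mul_add]
          congr 1
          · rw [mul_assoc, ← mul_assoc a, ← ((hc a).pow_left _).eq, ← add_assoc, pow_succ' τ (k + 1 + m)]
            simp only [mul_assoc]
          · rw [mul_assoc, ← mul_assoc c, ← ((hc c).pow_left _).eq, pow_add τ (k + 1) (m + 1)]
            simp only [mul_assoc]
      -- For `R = 0` the truncated exponential has no linear term to isolate, but then `τ = 0`.
      rcases Nat.eq_zero_or_pos R with hR | hR
      · subst hR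
        have h0 : τ = 0 := by simpa using hτ
        exact ⟨0, by simp [h0]⟩
      obtain ⟨r, rfl⟩ : ∃ r, R = r + 1 := ⟨R - 1, by omega⟩
      choose d hd using hpow
      rw [← sub_eq_zero, ← Finset.sum_sub_distrib, Finset.sum_range_succ',
        Finset.sum_range_succ'] at h
      simp only [zero_add, pow_one, Nat.factorial_one, Nat.cast_one, inv_one, one_smul,
        pow_zero, sub_self, add_zero, ← smul_sub] at h
      refine ⟨-∑ i ∈ range r, ((i + 1 + 1).factorial : ℚ)⁻¹ • (τ ^ i * d (i + 1)), ?_⟩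
      rw [← sub_eq_zero, ← h, mul_neg, Finset.mul_sum, sub_neg_eq_add, add_comm, add_left_inj]
      refine Finset.sum_congr rfl fun i _ => ?_
      rw [hd, mul_smul_comm, ← mul_assoc, ← pow_add]
      congr 3
      omega
  obtain ⟨c, hk⟩ := key R
  rw [hτ, zero_mul, sub_eq_zero] at hk
  exact hk

end Nilpotent

end BCHGroup

/-! ### Evaluation of noncommutative power series at a central nilpotent element -/

namespace BCHGroup

open Finset

section PowerSeriesEval

theorem coeff_pow_eq_zero_of_lt {A : Type*} [Ring A] {v : PowerSeries A}
    (hv : PowerSeries.coeff 0 v = 0) {n k : ℕ} (h : n < k) : PowerSeries.coeff n (v ^ k) = 0 := by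
  induction k generalizing n with
  | zero => omega
  | succ k ih =>
    rw [pow_succ', PowerSeries.coeff_mul]
    refine Finset.sum_eq_zero fun x hx => ?_
    rw [HasAntidiagonal.mem_antidiagonal] at hx
    rcases Nat.eq_zero_or_pos x.1 with h1 | h1
    · rw [h1, hv, zero_mul]
    · rw [ih (by omega), mul_zero]

variable {A B : Type*} [Ring A] [Algebra ℚ A] [Ring B] [Algebra ℚ B]

/-- The value at a central element `τ` with `τ ^ (R + 1) = 0` of a power series with coefficients
in `A`, where `g : A → B` is a homomorphism. -/
noncomputable def evalNilpotent (g : A →ₐ[ℚ] B) {τ : B} (hc : ∀ b, Commute τ b) {R : ℕ}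
    (hτ : τ ^ (R + 1) = 0) : PowerSeries A →+* B where
  toFun f := ∑ n ∈ range (R + 1), τ ^ n * g (PowerSeries.coeff n f)
  map_one' := by
    rw [Finset.sum_eq_single 0]
    · simp
    · intro n _ hn
      simp [PowerSeries.coeff_one, hn]
    · simp
  map_zero' := by simp
  map_add' f h := by simp [mul_add, Finset.sum_add_distrib]
  map_mul' f h := by
    set F : ℕ × ℕ → B := fun x => τ ^ (x.1 + x.2) *
      (g (PowerSeries.coeff x.1 f) * g (PowerSeries.coeff x.2 h)) with hF
    have h1 : ∀ n, τ ^ n * g (PowerSeries.coeff n (f * h)) = ∑ x ∈ antidiagonal n, F x := by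
      intro n
      rw [PowerSeries.coeff_mul, map_sum, Finset.mul_sum]
      refine Finset.sum_congr rfl fun x hx => ?_
      rw [hF, map_mul, ← HasAntidiagonal.mem_antidiagonal.1 hx]
    have h2 : ∀ x : ℕ × ℕ, τ ^ x.1 * g (PowerSeries.coeff x.1 f) *
        (τ ^ x.2 * g (PowerSeries.coeff x.2 h)) = F x := by
      intro x
      simp only [hF]
      rw [mul_assoc, ← mul_assoc (g _) (τ ^ x.2), ← ((hc _).pow_left x.2).eq, pow_add]
      simp only [mul_assoc]
    rw [Finset.sum_mul_sum, ← Finset.sum_product', Finset.sum_congr rfl fun n _ => h1 n,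
      Finset.sum_congr rfl fun x _ => h2 x]
    -- Pairs of total degree above `R` are killed by `τ^(R+1) = 0`; the others are grouped by total
    -- degree.
    set s := (range (R + 1) ×ˢ range (R + 1)).filter (fun x : ℕ × ℕ => x.1 + x.2 < R + 1) with hs
    rw [← Finset.sum_subset (Finset.filter_subset _ _ : s ⊆ _),
      ← Finset.sum_fiberwise_of_maps_to (s := s) (t := range (R + 1)) (g := fun x => x.1 + x.2)]
    · refine Finset.sum_congr rfl fun n hn => Finset.sum_congr ?_ fun _ _ => rfl
      ext x
      rw [hs]
      simp only [HasAntidiagonal.mem_antidiagonal, mem_filter, mem_product, mem_range] at hn ⊢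
      omega
    · intro x hx
      rw [hs] at hx
      simpa using (mem_filter.1 hx).2
    · intro x hx hx2
      have : R + 1 ≤ x.1 + x.2 := by
        by_contra h3
        exact hx2 (mem_filter.2 ⟨hx, by omega⟩)
      rw [pow_eq_zero_of_le this hτ, zero_mul]

variable (g : A →ₐ[ℚ] B) {τ : B} (hc : ∀ b, Commute τ b) {R : ℕ} (hτ : τ ^ (R + 1) = 0)

theorem evalNilpotent_apply (f : PowerSeries A) :
    evalNilpotent g hc hτ f = ∑ n ∈ range (R + 1), τ ^ n * g (PowerSeries.coeff n f) := rfl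

theorem exists_evalNilpotent_eq_mul {f : PowerSeries A} (hf : PowerSeries.coeff 0 f = 0) :
    ∃ c, evalNilpotent g hc hτ f = τ * c := by
  refine ⟨∑ n ∈ range R, τ ^ n * g (PowerSeries.coeff (n + 1) f), ?_⟩
  rw [evalNilpotent_apply, Finset.sum_range_succ', hf, map_zero, mul_zero, add_zero,
    Finset.mul_sum]
  simp only [pow_succ', mul_assoc]

end PowerSeriesEval

theorem evalNilpotent_expSeries {B : Type*} [Ring B] [Algebra ℚ B] (g : Assoc2 →ₐ[ℚ] B) {τ : B}
    (hc : ∀ b, Commute τ b) {R : ℕ} (hτ : τ ^ (R + 1) = 0) (a : Assoc2) :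
    evalNilpotent g hc hτ (expSeries a) = IsNilpotent.exp (τ * g a) := by
  rw [IsNilpotent.exp_eq_sum (mul_pow_eq_zero_of_central hc hτ _), evalNilpotent_apply]
  refine Finset.sum_congr rfl fun n _ => ?_
  rw [expSeries, PowerSeries.coeff_mk, map_smul, map_pow, (hc _).mul_pow, mul_smul_comm]

theorem sum_evalNilpotent_logComponent {B : Type*} [Ring B] [Algebra ℚ B] (g : Assoc2 →ₐ[ℚ] B)
    {τ : B} (hc : ∀ b, Commute τ b) {R : ℕ} (hτ : τ ^ (R + 1) = 0) {u : PowerSeries Assoc2}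
    (hu : PowerSeries.coeff 0 u = 1) :
    IsNilpotent.exp (∑ n ∈ Icc 1 R, τ ^ n * g (logComponent u n)) = evalNilpotent g hc hτ u := by
  have hv : PowerSeries.coeff 0 (u - 1) = 0 := by rw [map_sub, hu]; simp
  obtain ⟨c, hcc⟩ := exists_evalNilpotent_eq_mul g hc hτ hv
  have hz : (evalNilpotent g hc hτ (u - 1)) ^ (R + 1) = 0 := by
    rw [hcc]; exact mul_pow_eq_zero_of_central hc hτ c
  have h1 : ∑ n ∈ Icc 1 R, τ ^ n * g (logComponent u n) =
      ∑ k ∈ Icc 1 R, ((-1 : ℚ) ^ (k + 1) / (k : ℚ)) • (evalNilpotent g hc hτ (u - 1)) ^ k := by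
    -- The range of `k` may be extended from `n` to `R`, as `(u - 1)^k` has no component of degree
    -- below `k`. The two sums can then be exchanged.
    have e1 : ∀ n ∈ Icc 1 R, τ ^ n * g (logComponent u n) =
        ∑ k ∈ Icc 1 R, ((-1 : ℚ) ^ (k + 1) / (k : ℚ)) •
          (τ ^ n * g (PowerSeries.coeff n ((u - 1) ^ k))) := by
      intro n hn
      rw [logComponent, map_sum, Finset.mul_sum]
      rw [← Finset.sum_subset (Finset.Icc_subset_Icc_right (mem_Icc.1 hn).2)]
      · refine Finset.sum_congr rfl fun k _ => ?_
        rw [map_smul, mul_smul_comm]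
      · intro k hk hk2
        rw [coeff_pow_eq_zero_of_lt hv, map_zero, mul_zero, smul_zero]
        simp only [mem_Icc] at hk hk2
        omega
    rw [Finset.sum_congr rfl e1, Finset.sum_comm]
    refine Finset.sum_congr rfl fun k hk => ?_
    rw [← map_pow, evalNilpotent_apply, ← Finset.smul_sum]
    congr 1
    rw [Finset.sum_range_succ', coeff_pow_eq_zero_of_lt hv (mem_Icc.1 hk).1, map_zero, mul_zero,
      add_zero, Finset.range_eq_Ico, Finset.sum_Ico_add' (fun n => τ ^ n *
        g (PowerSeries.coeff n ((u - 1) ^ k))) 0 R 1]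
    rfl
  rw [h1, exp_log_of_pow_eq_zero hz, map_sub, map_one, add_sub_cancel]

theorem coeff_zero_expSeries_mul :
    PowerSeries.coeff 0 (expSeries (var 0) * expSeries (var 1)) = 1 := by
  simp [expSeries, PowerSeries.coeff_mul]

theorem exp_sum_bchComponent {B : Type*} [Ring B] [Algebra ℚ B] (g : Assoc2 →ₐ[ℚ] B)
    {τ : B} (hc : ∀ b, Commute τ b) {R : ℕ} (hτ : τ ^ (R + 1) = 0) :
    IsNilpotent.exp (∑ n ∈ Icc 1 R, τ ^ n * g (bchComponent n)) =
      IsNilpotent.exp (τ * g (var 0)) * IsNilpotent.exp (τ * g (var 1)) := by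
  simp only [bchComponent]
  rw [sum_evalNilpotent_logComponent g hc hτ coeff_zero_expSeries_mul, map_mul,
    evalNilpotent_expSeries, evalNilpotent_expSeries]

end BCHGroup

/-! ### Right-normed bracketing and Dynkin's theorem -/

namespace BCHGroup

attribute [local instance 100] LieRing.ofAssociativeRing

section Dynkin

variable {X L : Type*} [LieRing L] [LieAlgebra ℚ L]

/-- The endomorphism `(c, v) ↦ (0, c • y + ⁅x, v⁆)` of `ℚ × L`. -/
def affineAd (x y : L) : Module.End ℚ (ℚ × L) :=
  (LinearMap.inr ℚ ℚ L) ∘ₗ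
    ((LinearMap.toSpanSingleton ℚ L y) ∘ₗ (LinearMap.fst ℚ ℚ L) +
      ((LieAlgebra.ad ℚ L x : Module.End ℚ L)) ∘ₗ (LinearMap.snd ℚ ℚ L))

@[simp]
theorem affineAd_apply (x y : L) (w : ℚ × L) : affineAd x y w = (0, w.1 • y + ⁅x, w.2⁆) := by
  simp [affineAd]

/-- The right-normed bracketing of non-commutative polynomials: it is linear, kills `1`, and
sends `x₁ ⋯ xₙ` to `⁅a x₁, ⁅a x₂, …, a xₙ⁆⁆`. -/
noncomputable def dynkin (a : X → L) : FreeAlgebra ℚ X →ₗ[ℚ] L :=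
  (LinearMap.snd ℚ ℚ L) ∘ₗ (LinearMap.applyₗ ((1 : ℚ), (0 : L))) ∘ₗ
    (FreeAlgebra.lift ℚ fun i => affineAd (a i) (a i)).toLinearMap

theorem dynkin_apply (a : X → L) (P : FreeAlgebra ℚ X) :
    dynkin a P = ((FreeAlgebra.lift ℚ fun i => affineAd (a i) (a i)) P ((1 : ℚ), (0 : L))).2 := rfl

/-- The `ℚ` coordinate keeps track of the constant term. It is what lets the last letter of a word
enter as `a i` rather than be bracketed with `0`. -/
theorem lift_affineAd_fst (a : X → L) (P : FreeAlgebra ℚ X) (w : ℚ × L) :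
    ((FreeAlgebra.lift ℚ fun i => affineAd (a i) (a i)) P w).1 =
      FreeAlgebra.algebraMapInv P * w.1 := by
  induction P using FreeAlgebra.induction generalizing w with
  | grade0 r => simp [Module.algebraMap_end_apply, FreeAlgebra.algebraMapInv]
  | grade1 x => simp [FreeAlgebra.algebraMapInv]
  | mul a b ha hb => simp [ha, hb, mul_assoc]
  | add a b ha hb => simp [ha, hb, add_mul]

@[simp]
theorem dynkin_one (a : X → L) : dynkin a 1 = 0 := by simp [dynkin_apply]

theorem dynkin_ι_mul (a : X → L) (i : X) (P : FreeAlgebra ℚ X) :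
    dynkin a (FreeAlgebra.ι ℚ i * P) = FreeAlgebra.algebraMapInv P • a i + ⁅a i, dynkin a P⁆ := by
  rw [dynkin_apply, dynkin_apply, map_mul, Module.End.mul_apply, FreeAlgebra.lift_ι_apply,
    affineAd_apply, lift_affineAd_fst, mul_one]

@[simp]
theorem dynkin_ι (a : X → L) (i : X) : dynkin a (FreeAlgebra.ι ℚ i) = a i := by
  rw [← mul_one (FreeAlgebra.ι ℚ i), dynkin_ι_mul]
  simp

/-- The product of the variables in a list. -/
noncomputable def wordProd (l : List X) : FreeAlgebra ℚ X := (l.map (FreeAlgebra.ι ℚ)).prod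

@[simp] theorem wordProd_nil : wordProd ([] : List X) = 1 := rfl

@[simp] theorem wordProd_cons (i : X) (l : List X) :
    wordProd (i :: l) = FreeAlgebra.ι ℚ i * wordProd l := by simp [wordProd]

theorem wordProd_append (l l' : List X) : wordProd (l ++ l') = wordProd l * wordProd l' := by
  simp [wordProd]

theorem algebraMapInv_wordProd_cons (i : X) (l : List X) :
    FreeAlgebra.algebraMapInv (wordProd (i :: l)) = (0 : ℚ) := by
  simp [FreeAlgebra.algebraMapInv]

theorem span_wordProd : Submodule.span ℚ (Set.range (wordProd : List X → _)) = ⊤ := by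
  have key : ∀ P : FreeAlgebra ℚ X, ∀ Q ∈ Submodule.span ℚ (Set.range (wordProd : List X → _)),
      P * Q ∈ Submodule.span ℚ (Set.range (wordProd : List X → _)) := by
    intro P
    induction P using FreeAlgebra.induction with
    | grade0 r => intro Q hQ; rw [← Algebra.smul_def]; exact Submodule.smul_mem _ _ hQ
    | grade1 x =>
      intro Q hQ
      induction hQ using Submodule.span_induction with
      | mem Q hQ =>
        obtain ⟨l, rfl⟩ := hQ
        exact Submodule.subset_span ⟨x :: l, wordProd_cons x l⟩
      | zero => simp
      | add Q Q' _ _ h h' => rw [mul_add]; exact Submodule.add_mem _ h h'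
      | smul q Q _ h => rw [mul_smul_comm]; exact Submodule.smul_mem _ _ h
    | mul P P' h h' => intro Q hQ; rw [mul_assoc]; exact h _ (h' _ hQ)
    | add P P' h h' => intro Q hQ; rw [add_mul]; exact Submodule.add_mem _ (h _ hQ) (h' _ hQ)
  rw [eq_top_iff]
  intro P _
  simpa using key P 1 (Submodule.subset_span ⟨[], wordProd_nil⟩)

theorem dynkin_map {L' : Type*} [LieRing L'] [LieAlgebra ℚ L'] (f : L →ₗ⁅ℚ⁆ L') (a : X → L)
    (P : FreeAlgebra ℚ X) : f (dynkin a P) = dynkin (fun i => f (a i)) P := by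
  have : ∀ w : ℚ × L, ((FreeAlgebra.lift ℚ fun i => affineAd (f (a i)) (f (a i))) P (w.1, f w.2)) =
      (((FreeAlgebra.lift ℚ fun i => affineAd (a i) (a i)) P w).1,
        f ((FreeAlgebra.lift ℚ fun i => affineAd (a i) (a i)) P w).2) := by
    induction P using FreeAlgebra.induction with
    | grade0 r => intro w; simp [Module.algebraMap_end_apply]
    | grade1 x => intro w; simp
    | mul P Q hP hQ => intro w; simp [hP, hQ]
    | add P Q hP hQ => intro w; simp [hP, hQ]
  have h := this (1, 0)
  rw [dynkin_apply, dynkin_apply, ← map_zero f, h]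

/-- A derivation `θ` of `L` makes `affineAd x (θ x)` a representation of `L`. -/
noncomputable def affineAdHom (θ : LieDerivation ℚ L L) : L →ₗ⁅ℚ⁆ Module.End ℚ (ℚ × L) where
  toFun x := affineAd x (θ x)
  map_add' x y := by ext <;> simp
  map_smul' q x := by ext <;> simp
  map_lie' {x y} := by
    ext <;> simp [LieRing.of_associative_ring_bracket]
    
theorem lift_affineAd_lift (θ : LieDerivation ℚ L L) (a : X → L) (ha : ∀ i, θ (a i) = a i)
    (u : FreeLieAlgebra ℚ X) :
    (FreeAlgebra.lift ℚ fun i => affineAd (a i) (a i))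
      (FreeLieAlgebra.lift ℚ (FreeAlgebra.ι ℚ) u) =
      affineAd (FreeLieAlgebra.lift ℚ a u) (θ (FreeLieAlgebra.lift ℚ a u)) := by
  have : ((FreeAlgebra.lift ℚ fun i => affineAd (a i) (a i)) : _ →ₗ⁅ℚ⁆ _).comp
      (FreeLieAlgebra.lift ℚ (FreeAlgebra.ι ℚ)) =
      (affineAdHom θ).comp (FreeLieAlgebra.lift ℚ a) := by
    ext1 i
    simp [affineAdHom, ha]
  exact congrArg (fun F => F u) this

/-- A form of the Dynkin-Specht-Wever theorem: a derivation fixing the generators multiplies a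
bracket of `n` of them by `n`. It holds because `x ↦ affineAd x (θ x)` is a Lie homomorphism,
compared on generators with the one that defines `dynkin`. -/
theorem dynkin_lift (θ : LieDerivation ℚ L L) (a : X → L) (ha : ∀ i, θ (a i) = a i)
    (u : FreeLieAlgebra ℚ X) :
    dynkin a (FreeLieAlgebra.lift ℚ (FreeAlgebra.ι ℚ) u) = θ (FreeLieAlgebra.lift ℚ a u) := by
  rw [dynkin_apply, lift_affineAd_lift θ a ha]
  simp

end Dynkin

end BCHGroup

/-! ### Grading by `L[t]` and the embedding of the free Lie algebra -/

namespace BCHGroup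

attribute [local instance 100] LieRing.ofAssociativeRing

section PolynomialLie

open Polynomial

variable {L : Type*} [LieRing L] [LieAlgebra ℚ L]

/-- The coefficient of `tᴺ` of an element of the Lie algebra `L[t]`. -/
noncomputable def coeffPoly (N : ℕ) : ℚ[X] ⊗[ℚ] L →ₗ[ℚ] L :=
  (TensorProduct.lid ℚ L).toLinearMap ∘ₗ (Polynomial.lcoeff ℚ N).rTensor L

@[simp]
theorem coeffPoly_tmul (N : ℕ) (f : ℚ[X]) (u : L) : coeffPoly N (f ⊗ₜ[ℚ] u) = f.coeff N • u := by
  simp [coeffPoly]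

theorem coeffPoly_lie (N : ℕ) (P Q : ℚ[X] ⊗[ℚ] L) :
    coeffPoly N (LieRing.toBracket.bracket P Q) =
      ∑ x ∈ Finset.HasAntidiagonal.antidiagonal N, ⁅coeffPoly x.1 P, coeffPoly x.2 Q⁆ := by
  change coeffPoly N (LieAlgebra.ad ℚ (ℚ[X] ⊗[ℚ] L) P Q) = _
  induction P using TensorProduct.induction_on with
  | zero => simp
  | add P P' h h' =>
    simp only [map_add, LinearMap.add_apply, h, h', add_lie, Finset.sum_add_distrib]
  | tmul f u =>
    induction Q using TensorProduct.induction_on with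
    | zero => simp
    | add P P' h h' => simp only [map_add, h, h', lie_add, Finset.sum_add_distrib]
    | tmul g v =>
      rw [LieAlgebra.ad_apply, LieAlgebra.ExtendScalars.bracket_tmul, coeffPoly_tmul,
        Polynomial.coeff_mul, Finset.sum_smul]
      refine Finset.sum_congr rfl fun x _ => ?_
      rw [coeffPoly_tmul, coeffPoly_tmul, smul_lie, lie_smul, mul_smul]

/-- Evaluation of elements of the Lie algebra `L[t]` at `t = 1`. -/
noncomputable def evalPoly : ℚ[X] ⊗[ℚ] L →ₗ⁅ℚ⁆ L where
  toLinearMap := (TensorProduct.lid ℚ L).toLinearMap ∘ₗ (Polynomial.leval (1 : ℚ)).rTensor L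
  map_lie' {P Q} := by
    simp only [AddHom.toFun_eq_coe, LinearMap.coe_toAddHom]
    induction P using TensorProduct.induction_on with
    | zero => simp
    | add P P' h h' => simp only [add_lie, map_add, h, h']
    | tmul f u =>
      induction Q using TensorProduct.induction_on with
      | zero => simp
      | add P P' h h' => simp only [lie_add, map_add, h, h']
      | tmul g v => simp [LieAlgebra.ExtendScalars.bracket_tmul, mul_smul, smul_comm (eval 1 f)]

@[simp]
theorem evalPoly_tmul (f : ℚ[X]) (u : L) : evalPoly (f ⊗ₜ[ℚ] u) = f.eval 1 • u := by
  change (TensorProduct.lid ℚ L) ((Polynomial.leval (1 : ℚ)).rTensor L (f ⊗ₜ[ℚ] u)) = _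
  simp

theorem exists_evalPoly_eq_sum (P : ℚ[X] ⊗[ℚ] L) :
    ∃ d₀, ∀ d ≥ d₀, evalPoly P = ∑ n ∈ Finset.range d, coeffPoly n P := by
  induction P using TensorProduct.induction_on with
  | zero => exact ⟨0, by simp⟩
  | add P Q h h' =>
    obtain ⟨d, hd⟩ := h
    obtain ⟨d', hd'⟩ := h'
    refine ⟨max d d', fun e he => ?_⟩
    simp only [map_add, Finset.sum_add_distrib]
    rw [hd e (le_trans (le_max_left _ _) he), hd' e (le_trans (le_max_right _ _) he)]
  | tmul f u =>
    refine ⟨f.natDegree + 1, fun d hd => ?_⟩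
    simp only [evalPoly_tmul, coeffPoly_tmul]
    rw [← Finset.sum_smul, Polynomial.eval_eq_sum_range' (n := d) (by omega)]
    simp

theorem coeffPoly_ext {P Q : ℚ[X] ⊗[ℚ] L} (h : ∀ N, coeffPoly N P = coeffPoly N Q) :
    evalPoly P = evalPoly Q := by
  obtain ⟨d, hd⟩ := exists_evalPoly_eq_sum P
  obtain ⟨e, he⟩ := exists_evalPoly_eq_sum Q
  rw [hd _ (le_max_left d e), he _ (le_max_right d e)]
  exact Finset.sum_congr rfl fun n _ => h n

/-- The derivation `t d/dt` of `L[t]`. -/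
noncomputable def eulerDerivation : LieDerivation ℚ (ℚ[X] ⊗[ℚ] L) (ℚ[X] ⊗[ℚ] L) where
  toLinearMap := (LinearMap.mulLeft ℚ (X : ℚ[X]) ∘ₗ Polynomial.derivative).rTensor L
  leibniz' P Q := by
    induction P using TensorProduct.induction_on with
    | zero => simp
    | add P P' h h' =>
      simp only [add_lie, map_add, h, h', lie_add]; abel
    | tmul f u =>
      induction Q using TensorProduct.induction_on with
      | zero => simp
      | add P P' h h' => simp only [lie_add, map_add, h, h', add_lie]; abel
      | tmul g v =>
        simp only [LieAlgebra.ExtendScalars.bracket_tmul, LinearMap.rTensor_tmul,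
          LinearMap.comp_apply, LinearMap.mulLeft_apply, Polynomial.derivative_mul]
        rw [← lie_skew v u, TensorProduct.tmul_neg, sub_neg_eq_add, ← TensorProduct.add_tmul]
        congr 1
        ring

theorem eulerDerivation_tmul (f : ℚ[X]) (u : L) :
    eulerDerivation (f ⊗ₜ[ℚ] u) = (X * Polynomial.derivative f) ⊗ₜ[ℚ] u := rfl

theorem coeffPoly_eulerDerivation (N : ℕ) (P : ℚ[X] ⊗[ℚ] L) :
    coeffPoly N (eulerDerivation P) = (N : ℚ) • coeffPoly N P := by
  induction P using TensorProduct.induction_on with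
  | zero => simp
  | add P P' h h' => simp only [map_add, h, h', smul_add]
  | tmul f u =>
    rw [eulerDerivation_tmul, coeffPoly_tmul, coeffPoly_tmul, smul_smul]
    congr 1
    cases N with
    | zero => simp
    | succ n => rw [Polynomial.coeff_X_mul, Polynomial.coeff_derivative]; push_cast; ring

/-- The family `t a` in `L[t]`, for a family `a` in `L`. -/
noncomputable def scaled {ι : Type*} (a : ι → L) (i : ι) : ℚ[X] ⊗[ℚ] L := X ⊗ₜ[ℚ] a i

variable {ι : Type*}

theorem evalPoly_lift_scaled (a : ι → L) (u : FreeLieAlgebra ℚ ι) :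
    evalPoly (FreeLieAlgebra.lift ℚ (scaled a) u) = FreeLieAlgebra.lift ℚ a u := by
  have : evalPoly.comp (FreeLieAlgebra.lift ℚ (scaled a)) = FreeLieAlgebra.lift ℚ a := by
    ext1 i
    simp [scaled]
  exact congrArg (fun F => F u) this

/-- The constant coefficient is a Lie homomorphism that kills the generators. This settles degree
`0`, where Dynkin's theorem cannot be divided by the degree. -/
theorem coeffPoly_zero_lift_scaled (a : ι → L) (u : FreeLieAlgebra ℚ ι) :
    coeffPoly 0 (FreeLieAlgebra.lift ℚ (scaled a) u) = 0 := by
  let c : ℚ[X] ⊗[ℚ] L →ₗ⁅ℚ⁆ L :=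
    { coeffPoly 0 with
      map_lie' := fun {P Q} => by
        change coeffPoly 0 (LieRing.toBracket.bracket P Q) = ⁅coeffPoly 0 P, coeffPoly 0 Q⁆
        rw [coeffPoly_lie]; simp }
  have : c.comp (FreeLieAlgebra.lift ℚ (scaled a)) = 0 := by
    ext1 i
    change coeffPoly 0 (FreeLieAlgebra.lift ℚ (scaled a) (FreeLieAlgebra.of ℚ i)) = 0
    simp [scaled]
  exact congrArg (fun F => F u) this

/-- The homomorphism `ℚ⟨X⟩ → ℚ⟨X⟩[t]` that sends each variable `x` to `x t`, so that the
coefficients of the image are the homogeneous components. -/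
noncomputable def gradeHom : FreeAlgebra ℚ ι →ₐ[ℚ] (FreeAlgebra ℚ ι)[X] :=
  FreeAlgebra.lift ℚ fun i => Polynomial.monomial 1 (FreeAlgebra.ι ℚ i)

theorem gradeHom_wordProd (l : List ι) :
    gradeHom (wordProd l) = Polynomial.monomial l.length (wordProd l) := by
  induction l with
  | nil => simp
  | cons i l ih =>
    rw [wordProd_cons, map_mul, ih, gradeHom, FreeAlgebra.lift_ι_apply,
      Polynomial.monomial_mul_monomial, List.length_cons, add_comm]

theorem dynkin_scaled_wordProd (a : ι → L) (l : List ι) :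
    dynkin (scaled a) (wordProd l) = ((X : ℚ[X]) ^ l.length) ⊗ₜ[ℚ] dynkin a (wordProd l) := by
  induction l with
  | nil => simp
  | cons i l ih =>
    rw [wordProd_cons, dynkin_ι_mul, dynkin_ι_mul, ih, scaled,
      LieAlgebra.ExtendScalars.bracket_tmul, TensorProduct.tmul_add, List.length_cons, ← pow_succ']
    congr 1
    cases l with
    | nil => simp
    | cons j l => rw [algebraMapInv_wordProd_cons]; simp

theorem coeffPoly_dynkin_scaled (a : ι → L) (N : ℕ) (P : FreeAlgebra ℚ ι) :
    coeffPoly N (dynkin (scaled a) P) = dynkin a ((gradeHom P).coeff N) := by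
  have hP : P ∈ Submodule.span ℚ (Set.range (wordProd : List ι → _)) := by
    rw [span_wordProd]; trivial
  induction hP using Submodule.span_induction with
  | mem Q hQ =>
    obtain ⟨l, rfl⟩ := hQ
    rw [dynkin_scaled_wordProd, gradeHom_wordProd, coeffPoly_tmul, Polynomial.coeff_X_pow,
      Polynomial.coeff_monomial]
    by_cases h : N = l.length
    · simp [h]
    · simp [h, Ne.symm h]
  | zero => simp
  | add Q Q' _ _ h h' => simp only [map_add, h, h', Polynomial.coeff_add]
  | smul q Q _ h => simp only [map_smul, h, Polynomial.coeff_smul]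

theorem smul_coeffPoly_lift_scaled (a : ι → L) (N : ℕ) (u : FreeLieAlgebra ℚ ι) :
    (N : ℚ) • coeffPoly N (FreeLieAlgebra.lift ℚ (scaled a) u) =
      dynkin a ((gradeHom (FreeLieAlgebra.lift ℚ (FreeAlgebra.ι ℚ) u)).coeff N) := by
  rw [← coeffPoly_dynkin_scaled, dynkin_lift eulerDerivation, coeffPoly_eulerDerivation]
  intro i
  rw [scaled, eulerDerivation_tmul]
  simp

/-- The transfer principle: an identity checked in one degree of the free associative algebra holds
in that degree in every Lie algebra over `ℚ`. -/
theorem coeffPoly_lift_scaled_eq_zero (a : ι → L) {N : ℕ} {u : FreeLieAlgebra ℚ ι}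
    (h : (gradeHom (FreeLieAlgebra.lift ℚ (FreeAlgebra.ι ℚ) u)).coeff N = 0) :
    coeffPoly N (FreeLieAlgebra.lift ℚ (scaled a) u) = 0 := by
  rcases Nat.eq_zero_or_pos N with h0 | h0
  · subst h0; exact coeffPoly_zero_lift_scaled a u
  · have h1 := smul_coeffPoly_lift_scaled a N u
    rw [h, map_zero] at h1
    exact (smul_eq_zero.1 h1).resolve_left (by exact_mod_cast h0.ne')

/-- The free Lie algebra over `ℚ` embeds into the free associative algebra. -/
theorem freeLieAlgebra_lift_ι_injective :
    Function.Injective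
      (FreeLieAlgebra.lift ℚ (FreeAlgebra.ι ℚ) : FreeLieAlgebra ℚ ι → FreeAlgebra ℚ ι) := by
  rw [injective_iff_map_eq_zero]
  intro u hu
  have h1 : FreeLieAlgebra.lift ℚ (FreeLieAlgebra.of ℚ) u = u := by
    have : FreeLieAlgebra.lift ℚ (FreeLieAlgebra.of ℚ (X := ι)) = (LieHom.id) := by
      ext1 i; simp
    rw [this]; rfl
  -- With the free Lie algebra's own generators as the family, `u` is the value at `t = 1` of a
  -- polynomial whose coefficients all vanish by the transfer principle.
  rw [← h1, ← evalPoly_lift_scaled, ← map_zero (evalPoly (L := FreeLieAlgebra ℚ ι))]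
  refine coeffPoly_ext fun N => ?_
  rw [coeffPoly_lift_scaled_eq_zero _ (by rw [hu]; simp), map_zero]

end PolynomialLie

end BCHGroup

/-! ### Denominators of the Baker-Campbell-Hausdorff series -/

namespace BCHGroup

open Finset

section PadicNorm

variable {p : ℕ} [hp : Fact p.Prime]

theorem padicNorm_inv_natCast {k : ℕ} (hk : k ≠ 0) :
    padicNorm p ((k : ℚ)⁻¹) = (p : ℚ) ^ padicValNat p k := by
  rw [padicNorm.eq_zpow_of_nonzero (by simpa using hk), padicValRat.inv, neg_neg,
    padicValRat.of_nat, zpow_natCast]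

theorem sub_one_mul_padicValNat_factorial_le (k : ℕ) :
    (p - 1) * padicValNat p k.factorial ≤ k - 1 := by
  rcases eq_or_ne k 0 with h | h
  · simp [h]
  · have := sub_one_mul_padicValNat_factorial_lt_of_ne_zero p h
    omega

theorem sub_one_mul_padicValNat_le {k : ℕ} : (p - 1) * padicValNat p k ≤ k - 1 := by
  rcases eq_or_ne k 0 with h | h
  · simp [h]
  refine le_trans (Nat.mul_le_mul_left _ ?_) (sub_one_mul_padicValNat_factorial_le (p := p) k)
  exact (padicValNat_dvd_iff_le (Nat.factorial_ne_zero k)).1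
    (pow_padicValNat_dvd.trans (Nat.dvd_factorial (Nat.pos_of_ne_zero h) le_rfl))

theorem padicNorm_inv_natCast_pow_le {k : ℕ} (hk : k ≠ 0) :
    padicNorm p ((k : ℚ)⁻¹) ^ (p - 1) ≤ (p : ℚ) ^ (k - 1) := by
  rw [padicNorm_inv_natCast hk, ← pow_mul, mul_comm]
  exact pow_le_pow_right₀ (by exact_mod_cast hp.out.one_le) sub_one_mul_padicValNat_le

theorem padicNorm_inv_factorial_pow_le (k : ℕ) :
    padicNorm p ((k.factorial : ℚ)⁻¹) ^ (p - 1) ≤ (p : ℚ) ^ (k - 1) := by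
  rw [padicNorm_inv_natCast (Nat.factorial_ne_zero k), ← pow_mul, mul_comm]
  exact pow_le_pow_right₀ (by exact_mod_cast hp.out.one_le) (sub_one_mul_padicValNat_factorial_le k)

end PadicNorm

section WeightedWords

variable {X : Type*}

/-- The sums of terms `q • w`, where `w` is a word of length `n` and the rational number `q`
satisfies `|q|_p ^ (p - 1) ≤ p ^ m`. -/
def weightedWords (X : Type*) (p n m : ℕ) : AddSubgroup (FreeAlgebra ℚ X) :=
  AddSubgroup.closure {P | ∃ (q : ℚ) (l : List X), l.length = n ∧
    padicNorm p q ^ (p - 1) ≤ (p : ℚ) ^ m ∧ P = q • wordProd l}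

variable {p : ℕ}

theorem smul_wordProd_mem_weightedWords {q : ℚ} {l : List X} {n m : ℕ} (hl : l.length = n)
    (hq : padicNorm p q ^ (p - 1) ≤ (p : ℚ) ^ m) : q • wordProd l ∈ weightedWords X p n m :=
  AddSubgroup.subset_closure ⟨q, l, hl, hq, rfl⟩

theorem one_mem_weightedWords : (1 : FreeAlgebra ℚ X) ∈ weightedWords X p 0 0 := by
  have := smul_wordProd_mem_weightedWords (p := p) (q := 1) (l := ([] : List X)) (n := 0) (m := 0)
    rfl (by simp)
  simpa using this

theorem ι_pow_mem_weightedWords (i : X) (n : ℕ) :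
    (FreeAlgebra.ι ℚ i) ^ n ∈ weightedWords X p n 0 := by
  have := smul_wordProd_mem_weightedWords (p := p) (q := 1) (l := List.replicate n i) (n := n)
    (m := 0) (by simp) (by simp)
  simpa [wordProd] using this

variable [hp : Fact p.Prime]

theorem smul_mem_weightedWords {q : ℚ} {n m m' : ℕ} (hq : padicNorm p q ^ (p - 1) ≤ (p : ℚ) ^ m')
    {P : FreeAlgebra ℚ X} (hP : P ∈ weightedWords X p n m) :
    q • P ∈ weightedWords X p n (m + m') := by
  induction hP using AddSubgroup.closure_induction with
  | mem P h =>
    obtain ⟨r, l, hl, hr, rfl⟩ := h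
    rw [smul_smul]
    refine smul_wordProd_mem_weightedWords hl ?_
    rw [padicNorm.mul, mul_pow, mul_comm, pow_add]
    exact mul_le_mul hr hq (pow_nonneg (padicNorm.nonneg _) _) (by positivity)
  | zero => rw [smul_zero]; exact zero_mem _
  | add P Q _ _ h h' => rw [smul_add]; exact add_mem h h'
  | neg P _ h => rw [smul_neg]; exact neg_mem h

theorem mul_mem_weightedWords {n n' m m' : ℕ} {P Q : FreeAlgebra ℚ X}
    (hP : P ∈ weightedWords X p n m) (hQ : Q ∈ weightedWords X p n' m') :
    P * Q ∈ weightedWords X p (n + n') (m + m') := by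
  induction hP using AddSubgroup.closure_induction with
  | mem P h =>
    obtain ⟨r, l, hl, hr, rfl⟩ := h
    induction hQ using AddSubgroup.closure_induction with
    | mem Q h =>
      obtain ⟨s, l', hl', hs, rfl⟩ := h
      rw [smul_mul_smul_comm, ← wordProd_append]
      refine smul_wordProd_mem_weightedWords (by simp [hl, hl']) ?_
      rw [padicNorm.mul, mul_pow, pow_add]
      exact mul_le_mul hr hs (pow_nonneg (padicNorm.nonneg _) _) (by positivity)
    | zero => rw [mul_zero]; exact zero_mem _
    | add P Q _ _ h h' => rw [mul_add]; exact add_mem h h'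
    | neg P _ h => rw [mul_neg]; exact neg_mem h
  | zero => rw [zero_mul]; exact zero_mem _
  | add P Q _ _ h h' => rw [add_mul]; exact add_mem h h'
  | neg P _ h => rw [neg_mul]; exact neg_mem h

theorem weightedWords_mono {n m m' : ℕ} (h : m ≤ m') :
    weightedWords X p n m ≤ weightedWords X p n m' := by
  apply AddSubgroup.closure_mono
  rintro P ⟨q, l, hl, hq, rfl⟩
  exact ⟨q, l, hl, hq.trans (pow_le_pow_right₀ (by exact_mod_cast hp.out.one_le) h), rfl⟩

end WeightedWords

section Bch

variable {p : ℕ} [hp : Fact p.Prime]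

theorem coeff_expSeries_mul_mem (n : ℕ) :
    PowerSeries.coeff n (expSeries (var 0) * expSeries (var 1)) ∈
      weightedWords (Fin 2) p n (n - 1) := by
  rw [PowerSeries.coeff_mul]
  refine sum_mem fun x hx => ?_
  have hx' := HasAntidiagonal.mem_antidiagonal.1 hx
  rw [expSeries, expSeries, PowerSeries.coeff_mk, PowerSeries.coeff_mk]
  have h0 := smul_mem_weightedWords (padicNorm_inv_factorial_pow_le (p := p) x.1)
    (ι_pow_mem_weightedWords (p := p) (0 : Fin 2) x.1)
  have h1 := smul_mem_weightedWords (padicNorm_inv_factorial_pow_le (p := p) x.2)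
    (ι_pow_mem_weightedWords (p := p) (1 : Fin 2) x.2)
  have h2 := mul_mem_weightedWords h0 h1
  rw [hx'] at h2
  exact weightedWords_mono (by omega) h2

theorem coeff_pow_mem_weightedWords {v : PowerSeries Assoc2} (h0 : PowerSeries.coeff 0 v = 0)
    (h : ∀ n, PowerSeries.coeff n v ∈ weightedWords (Fin 2) p n (n - 1)) (k n : ℕ) :
    PowerSeries.coeff n (v ^ k) ∈ weightedWords (Fin 2) p n (n - k) := by
  induction k generalizing n with
  | zero =>
    rw [pow_zero, PowerSeries.coeff_one]
    split_ifs with hn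
    · subst hn; exact one_mem_weightedWords
    · exact zero_mem _
  | succ k ih =>
    rw [pow_succ', PowerSeries.coeff_mul]
    refine sum_mem fun x hx => ?_
    have hx' := HasAntidiagonal.mem_antidiagonal.1 hx
    rcases Nat.eq_zero_or_pos x.1 with h1 | h1
    · rw [h1, h0, zero_mul]; exact zero_mem _
    -- The subtraction in `x.2 - k` is truncated, so for `x.2 < k` the weights would not add up;
    -- there the coefficient vanishes.
    rcases lt_or_ge x.2 k with h2 | h2
    · rw [coeff_pow_eq_zero_of_lt h0 h2, mul_zero]; exact zero_mem _
    have h3 := mul_mem_weightedWords (h x.1) (ih x.2)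
    rw [hx'] at h3
    exact weightedWords_mono (by omega) h3

/-- By Legendre's formula a factor of degree `d ≥ 1` costs weight `d - 1`, so `k` factors of total
degree `n` cost `n - k`. The factor `1/k` costs `k - 1`, and the total is `n - 1` for every `k`.
Raising norms to the power `p - 1` keeps these weights integral. -/
theorem bchComponent_mem_weightedWords (n : ℕ) :
    bchComponent n ∈ weightedWords (Fin 2) p n (n - 1) := by
  rw [bchComponent, logComponent]
  refine sum_mem fun k hk => ?_
  rw [mem_Icc] at hk
  have hk0 : k ≠ 0 := by omega
  have h1 : PowerSeries.coeff n ((expSeries (var 0) * expSeries (var 1) - 1) ^ k) ∈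
      weightedWords (Fin 2) p n (n - k) := by
    apply coeff_pow_mem_weightedWords
    · rw [map_sub, coeff_zero_expSeries_mul]; simp
    · intro m
      rw [map_sub, PowerSeries.coeff_one]
      split_ifs with hm
      · rw [hm, coeff_zero_expSeries_mul, sub_self]; exact zero_mem _
      · rw [sub_zero]; exact coeff_expSeries_mul_mem m
  have h2 : padicNorm p ((-1 : ℚ) ^ (k + 1) / (k : ℚ)) ^ (p - 1) ≤ (p : ℚ) ^ (k - 1) := by
    rw [div_eq_mul_inv, padicNorm.mul]
    have : padicNorm p ((-1 : ℚ) ^ (k + 1)) = 1 := by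
      rcases neg_one_pow_eq_or ℚ (k + 1) with h | h <;> rw [h] <;> simp
    rw [this, one_mul]
    exact padicNorm_inv_natCast_pow_le hk0
  exact weightedWords_mono (by omega) (smul_mem_weightedWords h2 h1)

end Bch

end BCHGroup

/-! ### Primitivity of `Hₙ` and its expression as a Lie word -/

namespace BCHGroup

attribute [local instance 100] LieRing.ofAssociativeRing

open Finset

section Truncated

open Polynomial

variable (C : Type*) [Ring C] [Algebra ℚ C] (R : ℕ)

instance isTwoSided_span_X_pow : (Ideal.span {(X : C[X]) ^ (R + 1)}).IsTwoSided where
  mul_mem_of_left {a} b ha := by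
    rw [Ideal.mem_span_singleton'] at ha ⊢
    obtain ⟨c, rfl⟩ := ha
    refine ⟨c * b, ?_⟩
    rw [mul_assoc, mul_assoc, ((commute_X b).pow_left _).eq]

/-- The truncated polynomial ring `C[t] / (t ^ (R + 1))`. -/
abbrev TruncPoly : Type _ := C[X] ⧸ Ideal.span {(X : C[X]) ^ (R + 1)}

/-- The projection `C[t] → C[t] / (t ^ (R + 1))`. -/
noncomputable abbrev truncMk : C[X] →ₐ[ℚ] TruncPoly C R := Ideal.Quotient.mkₐ ℚ _

variable {C R}

theorem truncMk_X_commute (b : TruncPoly C R) : Commute (truncMk C R X) b := by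
  obtain ⟨f, rfl⟩ := Ideal.Quotient.mkₐ_surjective ℚ _ b
  exact (commute_X f).map (truncMk C R)

theorem truncMk_X_pow : (truncMk C R X) ^ (R + 1) = 0 := by
  rw [← map_pow]
  exact Ideal.Quotient.eq_zero_iff_mem.2 (Ideal.mem_span_singleton_self _)

theorem coeff_eq_of_truncMk_eq {f g : C[X]} (h : truncMk C R f = truncMk C R g) {n : ℕ}
    (hn : n ≤ R) : f.coeff n = g.coeff n := by
  have h1 := Ideal.Quotient.eq.1 h
  obtain ⟨c, hc⟩ := Ideal.mem_span_singleton'.1 h1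
  rw [← sub_eq_zero, ← Polynomial.coeff_sub, ← hc, Polynomial.coeff_mul_X_pow', if_neg (by omega)]

end Truncated

section Friedrichs

/-- Both sides have the same exponential: the four factors `exp (τ gᵢ(xⱼ))` can be regrouped by `i`,
since the images of `g₁` and `g₂` commute. Injectivity of `exp` then concludes. -/
theorem sum_bchComponent_of_commute {B : Type*} [Ring B] [Algebra ℚ B] {τ : B}
    (hc : ∀ b, Commute τ b) {R : ℕ} (hτ : τ ^ (R + 1) = 0) (g g₁ g₂ : Assoc2 →ₐ[ℚ] B)
    (hg : ∀ i, g (var i) = g₁ (var i) + g₂ (var i)) (hcomm : ∀ a b, Commute (g₁ a) (g₂ b)) :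
    ∑ n ∈ Icc 1 R, τ ^ n * g (bchComponent n) =
      ∑ n ∈ Icc 1 R, τ ^ n * g₁ (bchComponent n) + ∑ n ∈ Icc 1 R, τ ^ n * g₂ (bchComponent n) := by
  have hdiv : ∀ f : Assoc2 →ₐ[ℚ] B, ∃ s, ∑ n ∈ Icc 1 R, τ ^ n * f (bchComponent n) = τ * s := by
    intro f
    refine ⟨∑ n ∈ Icc 1 R, τ ^ (n - 1) * f (bchComponent n), ?_⟩
    rw [Finset.mul_sum]
    refine Finset.sum_congr rfl fun n hn => ?_
    rw [← mul_assoc, ← pow_succ', Nat.sub_add_cancel (mem_Icc.1 hn).1]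
  have hnil : ∀ s, IsNilpotent (τ * s) := fun s => ⟨R + 1, mul_pow_eq_zero_of_central hc hτ s⟩
  have hc' : ∀ a b, Commute (τ * g₁ a) (τ * g₂ b) := fun a b =>
    ((hc _).mul_right (hc _)).mul_left (((hc _).symm).mul_right (hcomm a b))
  have h12 : Commute (∑ n ∈ Icc 1 R, τ ^ n * g₁ (bchComponent n))
      (∑ n ∈ Icc 1 R, τ ^ n * g₂ (bchComponent n)) := by
    refine Commute.sum_left _ _ _ fun n _ => Commute.sum_right _ _ _ fun m _ => ?_
    exact ((hc _).pow_left n).mul_left ((((hc _).pow_left m).symm).mul_right (hcomm _ _))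
  have e := exp_sum_bchComponent g hc hτ
  have e₁ := exp_sum_bchComponent g₁ hc hτ
  have e₂ := exp_sum_bchComponent g₂ hc hτ
  obtain ⟨s, hs⟩ := hdiv g
  obtain ⟨s₁, hs₁⟩ := hdiv g₁
  obtain ⟨s₂, hs₂⟩ := hdiv g₂
  rw [hs₁, hs₂] at h12
  rw [hs] at e
  rw [hs₁] at e₁
  rw [hs₂] at e₂
  rw [hs, hs₁, hs₂, ← mul_add]
  apply exp_injective_of_central hc hτ
  rw [mul_add, IsNilpotent.exp_add_of_commute h12 (hnil _) (hnil _), e, e₁, e₂, hg, hg, mul_add,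
    mul_add, IsNilpotent.exp_add_of_commute (hc' _ _) (hnil _) (hnil _),
    IsNilpotent.exp_add_of_commute (hc' _ _) (hnil _) (hnil _)]
  have h3 : Commute (IsNilpotent.exp (τ * g₁ (var 1))) (IsNilpotent.exp (τ * g₂ (var 0))) := by
    rw [IsNilpotent.exp_eq_sum (mul_pow_eq_zero_of_central hc hτ _),
      IsNilpotent.exp_eq_sum (mul_pow_eq_zero_of_central hc hτ _)]
    refine Commute.sum_left _ _ _ fun n _ => Commute.sum_right _ _ _ fun m _ => ?_
    exact (((hc' _ _).pow_pow n m).smul_left _).smul_right _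
  simp only [mul_assoc]
  rw [← mul_assoc (IsNilpotent.exp (τ * g₂ (var 0))) (IsNilpotent.exp (τ * g₁ (var 1))), ← h3.eq]
  simp only [mul_assoc]

variable {X : Type*}

/-- The comultiplication of the free associative algebra, for which the variables are primitive. -/
noncomputable def freeComul : FreeAlgebra ℚ X →ₐ[ℚ] FreeAlgebra ℚ X ⊗[ℚ] FreeAlgebra ℚ X :=
  FreeAlgebra.lift ℚ fun i => FreeAlgebra.ι ℚ i ⊗ₜ 1 + 1 ⊗ₜ FreeAlgebra.ι ℚ i

/-- The images `P ⊗ 1` and `1 ⊗ Q` commute, so the previous additivity applies over the truncated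
polynomials in `t`; the coefficient of `tⁿ` is the claim. -/
theorem freeComul_bchComponent {n : ℕ} (hn : 1 ≤ n) :
    freeComul (bchComponent n) = bchComponent n ⊗ₜ 1 + 1 ⊗ₜ bchComponent n := by
  let G : (Assoc2 →ₐ[ℚ] Assoc2 ⊗[ℚ] Assoc2) → (Assoc2 →ₐ[ℚ] TruncPoly (Assoc2 ⊗[ℚ] Assoc2) n) :=
    fun f => (truncMk _ n).comp (Polynomial.CAlgHom.comp f)
  have hG : ∀ f, ∑ m ∈ Icc 1 n, (truncMk _ n Polynomial.X) ^ m * G f (bchComponent m) =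
      truncMk _ n (∑ m ∈ Icc 1 n, Polynomial.X ^ m * Polynomial.C (f (bchComponent m))) := by
    intro f
    rw [map_sum]
    refine Finset.sum_congr rfl fun m _ => ?_
    rw [map_mul, map_pow]
    rfl
  have key := sum_bchComponent_of_commute truncMk_X_commute truncMk_X_pow (G freeComul)
    (G Algebra.TensorProduct.includeLeft) (G Algebra.TensorProduct.includeRight) (by
      intro i
      simp only [G, AlgHom.comp_apply]
      rw [← map_add, ← map_add]
      simp [freeComul, var]) (by
      intro a b
      simp only [G, AlgHom.comp_apply]
      refine Commute.map (Commute.map ?_ _) _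
      simp [Commute, SemiconjBy])
  rw [hG, hG, hG, ← map_add] at key
  have h1 := coeff_eq_of_truncMk_eq key le_rfl
  have h2 : ∀ f : ℕ → Assoc2 ⊗[ℚ] Assoc2,
      (∑ m ∈ Icc 1 n, Polynomial.X ^ m * Polynomial.C (f m)).coeff n = f n := by
    intro f
    rw [Polynomial.finsetSum_coeff]
    simp only [Polynomial.coeff_mul_C, Polynomial.coeff_X_pow, ite_mul, one_mul, zero_mul]
    rw [Finset.sum_ite_eq]
    simp [hn]
  rw [Polynomial.coeff_add, h2, h2, h2] at h1
  simpa using h1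

/-- The map `P ⊗ Q ↦ D(P) Q`, where `D` is the right-normed bracketing. -/
noncomputable def dynkinMul : FreeAlgebra ℚ X ⊗[ℚ] FreeAlgebra ℚ X →ₗ[ℚ] FreeAlgebra ℚ X :=
  LinearMap.mul' ℚ (FreeAlgebra ℚ X) ∘ₗ (dynkin (FreeAlgebra.ι ℚ)).rTensor (FreeAlgebra ℚ X)

theorem dynkinMul_tmul (P Q : FreeAlgebra ℚ X) :
    dynkinMul (P ⊗ₜ Q) = dynkin (FreeAlgebra.ι ℚ) P * Q := by simp [dynkinMul]

/-- The map `P ⊗ Q ↦ ε(P) Q`, where `ε` is the augmentation. -/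
noncomputable def counitMul : FreeAlgebra ℚ X ⊗[ℚ] FreeAlgebra ℚ X →ₗ[ℚ] FreeAlgebra ℚ X :=
  (TensorProduct.lid ℚ _).toLinearMap ∘ₗ
    (FreeAlgebra.algebraMapInv (R := ℚ)).toLinearMap.rTensor (FreeAlgebra ℚ X)

theorem counitMul_tmul (P Q : FreeAlgebra ℚ X) :
    counitMul (P ⊗ₜ Q) = FreeAlgebra.algebraMapInv P • Q := by simp [counitMul]

theorem counitMul_freeComul_ι_mul (i : X) (ξ : FreeAlgebra ℚ X ⊗[ℚ] FreeAlgebra ℚ X) :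
    counitMul (freeComul (FreeAlgebra.ι ℚ i) * ξ) = FreeAlgebra.ι ℚ i * counitMul ξ := by
  induction ξ using TensorProduct.induction_on with
  | zero => simp
  | add ξ ξ' h h' => rw [mul_add, map_add, h, h', map_add, mul_add]
  | tmul P Q =>
    have : FreeAlgebra.algebraMapInv (FreeAlgebra.ι ℚ i) = (0 : ℚ) := by
      simp [FreeAlgebra.algebraMapInv]
    rw [freeComul, FreeAlgebra.lift_ι_apply, add_mul, Algebra.TensorProduct.tmul_mul_tmul,
      Algebra.TensorProduct.tmul_mul_tmul, map_add, counitMul_tmul, counitMul_tmul,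
      counitMul_tmul, map_mul, this]
    simp

theorem counitMul_freeComul_wordProd (l : List X) : counitMul (freeComul (wordProd l)) = wordProd l := by
  induction l with
  | nil => simp [Algebra.TensorProduct.one_def, counitMul_tmul]
  | cons i l ih => rw [wordProd_cons, map_mul, counitMul_freeComul_ι_mul, ih]

/-- For `ξ = P ⊗ Q` and a letter `x`, the part `-D(P) x Q` of `D(xP) Q` cancels the contribution of
`1 ⊗ x`. The surviving term `ε(P) x Q` adds one to the length count. -/
theorem dynkinMul_freeComul_ι_mul (i : X) (ξ : FreeAlgebra ℚ X ⊗[ℚ] FreeAlgebra ℚ X) :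
    dynkinMul (freeComul (FreeAlgebra.ι ℚ i) * ξ) =
      FreeAlgebra.ι ℚ i * dynkinMul ξ + FreeAlgebra.ι ℚ i * counitMul ξ := by
  induction ξ using TensorProduct.induction_on with
  | zero => simp
  | add ξ ξ' h h' => rw [mul_add, map_add, h, h', map_add, map_add, mul_add, mul_add]; abel
  | tmul P Q =>
    rw [freeComul, FreeAlgebra.lift_ι_apply, add_mul, Algebra.TensorProduct.tmul_mul_tmul,
      Algebra.TensorProduct.tmul_mul_tmul, map_add, counitMul_tmul, dynkinMul_tmul,
      dynkinMul_tmul, dynkinMul_tmul, dynkin_ι_mul, LieRing.of_associative_ring_bracket]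
    simp only [one_mul, add_mul, sub_mul, smul_mul_assoc, mul_smul_comm, mul_assoc]
    abel

theorem dynkinMul_freeComul_wordProd (l : List X) :
    dynkinMul (freeComul (wordProd l)) = (l.length : ℚ) • wordProd l := by
  induction l with
  | nil => simp [Algebra.TensorProduct.one_def, dynkinMul_tmul]
  | cons i l ih =>
    rw [wordProd_cons, map_mul, dynkinMul_freeComul_ι_mul, ih, counitMul_freeComul_wordProd,
      List.length_cons, mul_smul_comm]
    push_cast
    rw [add_smul, one_smul]

theorem dynkinMul_freeComul_of_mem {p n m : ℕ} {P : FreeAlgebra ℚ X}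
    (hP : P ∈ weightedWords X p n m) : dynkinMul (freeComul P) = (n : ℚ) • P := by
  induction hP using AddSubgroup.closure_induction with
  | mem P h =>
    obtain ⟨r, l, hl, hr, rfl⟩ := h
    rw [map_smul, map_smul, dynkinMul_freeComul_wordProd, hl, smul_comm]
  | zero => simp
  | add P Q _ _ h h' => rw [map_add, map_add, h, h', smul_add]
  | neg P _ h => rw [map_neg, map_neg, h, smul_neg]

/-- On a primitive `P` the convolution is `D(P) · 1 + D(1) · P = D(P)`, while by homogeneity it is
`n P`. -/
theorem dynkin_ι_bchComponent (n : ℕ) :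
    dynkin (FreeAlgebra.ι ℚ) (bchComponent n) = (n : ℚ) • bchComponent n := by
  rcases Nat.eq_zero_or_pos n with hn | hn
  · subst hn
    simp [bchComponent, logComponent]
  -- Only the homogeneity recorded by `weightedWords` matters here, so any prime serves.
  have := Nat.fact_prime_two
  rw [← dynkinMul_freeComul_of_mem (bchComponent_mem_weightedWords (p := 2) n),
    freeComul_bchComponent hn, map_add, dynkinMul_tmul, dynkinMul_tmul]
  simp

end Friedrichs

/-- The Lie word that represents the component of degree `n` of the Baker-Campbell-Hausdorff
series. -/
noncomputable def bchWord (n : ℕ) : LieWord :=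
  (n : ℚ)⁻¹ • dynkin (FreeLieAlgebra.of ℚ) (bchComponent n)

theorem toAssoc_bchWord (n : ℕ) : (bchWord n).toAssoc = bchComponent n := by
  rw [bchWord, LieWord.toAssoc, map_smul, dynkin_map]
  simp only [FreeLieAlgebra.lift_of_apply]
  change (n : ℚ)⁻¹ • dynkin (FreeAlgebra.ι ℚ) _ = _
  rw [dynkin_ι_bchComponent]
  rcases Nat.eq_zero_or_pos n with hn | hn
  · subst hn
    simp [bchComponent, logComponent]
  · rw [inv_smul_smul₀]
    exact_mod_cast hn.ne'

theorem toAssoc_eq_bchComponent_iff (n : ℕ) (w : LieWord) :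
    w.toAssoc = bchComponent n ↔ w = bchWord n := by
  rw [← toAssoc_bchWord]
  exact freeLieAlgebra_lift_ι_injective.eq_iff

/-- This reduces every estimate to right-normed brackets, at the price of the factor `1/n`. -/
theorem lift_bchWord {L : Type*} [LieRing L] [LieAlgebra ℚ L] (a : Fin 2 → L) (n : ℕ) :
    FreeLieAlgebra.lift ℚ a (bchWord n) = (n : ℚ)⁻¹ • dynkin a (bchComponent n) := by
  rw [bchWord, map_smul, dynkin_map]
  simp only [FreeLieAlgebra.lift_of_apply]

end BCHGroup

/-! ### Lie lattices: integrality, convergence and continuity -/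

namespace BCHGroup

attribute [local instance 100] LieRing.ofAssociativeRing

open Finset

section Lattice

variable {L : Type*} [LieRing L] [LieAlgebra ℚ L]

/-- A subgroup of a Lie algebra over `ℚ` that is closed under the bracket and under multiplication
by `p`-integral rational numbers. -/
structure IsLieLattice (p : ℕ) (Λ : AddSubgroup L) : Prop where
  smul_mem : ∀ {q : ℚ} {x : L}, padicNorm p q ≤ 1 → x ∈ Λ → q • x ∈ Λ
  lie_mem : ∀ {x y : L}, x ∈ Λ → y ∈ Λ → ⁅x, y⁆ ∈ Λ

/-- The subgroup `pᵏ Λ`. -/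
def pPowMul (p : ℕ) (Λ : AddSubgroup L) (k : ℕ) : AddSubgroup L :=
  Λ.map (DistribSMul.toAddMonoidHom L ((p : ℚ) ^ k))

theorem mem_pPowMul {p : ℕ} {Λ : AddSubgroup L} {k : ℕ} {x : L} :
    x ∈ pPowMul p Λ k ↔ ∃ y ∈ Λ, (p : ℚ) ^ k • y = x := by
  simp [pPowMul]

theorem pPowMul_zero {p : ℕ} {Λ : AddSubgroup L} : pPowMul p Λ 0 = Λ := by
  ext x; simp [mem_pPowMul]

variable {p : ℕ} {Λ : AddSubgroup L}

theorem IsLieLattice.lie_mem_pPowMul (hΛ : IsLieLattice p Λ) {i j : ℕ} {x y : L}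
    (hx : x ∈ pPowMul p Λ i) (hy : y ∈ pPowMul p Λ j) : ⁅x, y⁆ ∈ pPowMul p Λ (i + j) := by
  obtain ⟨x', hx', rfl⟩ := mem_pPowMul.1 hx
  obtain ⟨y', hy', rfl⟩ := mem_pPowMul.1 hy
  exact mem_pPowMul.2 ⟨_, hΛ.lie_mem hx' hy', by rw [smul_lie, lie_smul, smul_smul, pow_add]⟩

theorem IsLieLattice.dynkin_wordProd_mem (hΛ : IsLieLattice p Λ) {X : Type*} {a : X → L} {e : ℕ}
    (ha : ∀ i, a i ∈ pPowMul p Λ e) (l : List X) :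
    dynkin a (wordProd l) ∈ pPowMul p Λ (e * l.length) := by
  induction l with
  | nil => simp [zero_mem]
  | cons i l ih =>
    rw [wordProd_cons, dynkin_ι_mul]
    cases l with
    | nil => simpa using ha i
    | cons j l =>
      rw [algebraMapInv_wordProd_cons, zero_smul, zero_add, List.length_cons, mul_add, mul_one,
        add_comm]
      exact hΛ.lie_mem_pPowMul (ha i) ih

variable [hp : Fact p.Prime]

theorem padicNorm_natCast_pow (k : ℕ) : padicNorm p ((p : ℚ) ^ k) = ((p : ℚ) ^ k)⁻¹ := by
  induction k with
  | zero => simp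
  | succ k ih => rw [pow_succ, padicNorm.mul, ih, padicNorm.padicNorm_p_of_prime, mul_inv]

theorem IsLieLattice.smul_mem_pPowMul (hΛ : IsLieLattice p Λ) {q : ℚ} {i k : ℕ} {x : L}
    (hq : padicNorm p q * (p : ℚ) ^ k ≤ (p : ℚ) ^ i) (hx : x ∈ pPowMul p Λ i) :
    q • x ∈ pPowMul p Λ k := by
  have hp0 : (0 : ℚ) < p := by exact_mod_cast hp.out.pos
  obtain ⟨y, hy, rfl⟩ := mem_pPowMul.1 hx
  refine mem_pPowMul.2 ⟨(q * (p : ℚ) ^ i / (p : ℚ) ^ k) • y, hΛ.smul_mem ?_ hy, ?_⟩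
  · rw [padicNorm.div, padicNorm.mul, padicNorm_natCast_pow, padicNorm_natCast_pow, div_inv_eq_mul,
      mul_right_comm, ← div_eq_mul_inv, div_le_one (by positivity)]
    exact hq
  · rw [smul_smul, smul_smul, mul_div_cancel₀]
    positivity

theorem IsLieLattice.pPowMul_anti (hΛ : IsLieLattice p Λ) {j k : ℕ} (h : j ≤ k) :
    pPowMul p Λ k ≤ pPowMul p Λ j := by
  intro x hx
  rw [← one_smul ℚ x]
  refine hΛ.smul_mem_pPowMul ?_ hx
  rw [padicNorm.one, one_mul]
  exact pow_le_pow_right₀ (by exact_mod_cast hp.out.one_le) h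

theorem padicNorm_le_of_pow_le {q : ℚ} {m : ℕ} (h : padicNorm p q ^ (p - 1) ≤ (p : ℚ) ^ m) :
    padicNorm p q ≤ (p : ℚ) ^ (m / (p - 1)) := by
  have hp1 : (1 : ℚ) < p := by exact_mod_cast hp.out.one_lt
  have hp2 := hp.out.two_le
  rcases eq_or_ne q 0 with hq | hq
  · rw [hq, padicNorm.zero]; positivity
  rw [padicNorm.eq_zpow_of_nonzero hq, ← zpow_natCast, ← zpow_mul, ← zpow_natCast,
    zpow_le_zpow_iff_right₀ hp1] at h
  rw [padicNorm.eq_zpow_of_nonzero hq, ← zpow_natCast, zpow_le_zpow_iff_right₀ hp1]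
  push_cast
  rw [Int.le_ediv_iff_mul_le (by omega)]
  exact h

theorem IsLieLattice.lift_bchWord_mem (hΛ : IsLieLattice p Λ) {a : Fin 2 → L} {e : ℕ}
    (ha : ∀ i, a i ∈ pPowMul p Λ e) {n k : ℕ}
    (hk : k + (n - 1) / (p - 1) + padicValNat p n ≤ e * n) :
    FreeLieAlgebra.lift ℚ a (bchWord n) ∈ pPowMul p Λ k := by
  rw [lift_bchWord]
  rcases Nat.eq_zero_or_pos n with hn | hn
  · subst hn; simp [zero_mem]
  have hp1 : (1 : ℚ) ≤ p := by exact_mod_cast hp.out.one_le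
  have key : ∀ P ∈ weightedWords (Fin 2) p n (n - 1),
      (n : ℚ)⁻¹ • dynkin a P ∈ pPowMul p Λ k := by
    intro P hP
    induction hP using AddSubgroup.closure_induction with
    | mem P h =>
      obtain ⟨q, l, hl, hq, rfl⟩ := h
      rw [map_smul, smul_smul]
      refine hΛ.smul_mem_pPowMul (i := e * n) ?_ (hl ▸ hΛ.dynkin_wordProd_mem ha l)
      rw [padicNorm.mul, padicNorm_inv_natCast hn.ne']
      calc (p : ℚ) ^ padicValNat p n * padicNorm p q * (p : ℚ) ^ k
          ≤ (p : ℚ) ^ padicValNat p n * (p : ℚ) ^ ((n - 1) / (p - 1)) * (p : ℚ) ^ k := by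
            gcongr
            exact padicNorm_le_of_pow_le hq
        _ = (p : ℚ) ^ (padicValNat p n + (n - 1) / (p - 1) + k) := by rw [pow_add, pow_add]
        _ ≤ (p : ℚ) ^ (e * n) := pow_le_pow_right₀ hp1 (by omega)
    | zero => simp [zero_mem]
    | add P Q _ _ h h' => rw [map_add, smul_add]; exact add_mem h h'
    | neg P _ h => rw [map_neg, smul_neg]; exact neg_mem h
  exact key _ (bchComponent_mem_weightedWords n)

/-- The exponent of `p` in the number `boldP p`. -/
def boldExp (p : ℕ) : ℕ := if p = 2 then 2 else 1

theorem boldP_eq_pow (p : ℕ) : boldP p = p ^ boldExp p := by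
  unfold boldP boldExp
  split_ifs with h
  · subst h; rfl
  · simp

/-- Both losses are at most `(n-1)/(p-1)`. Their sum is at most `n - 1` for odd `p`, but can only be
bounded by `2(n-1)` for `p = 2`, whence the exponent `2` there. -/
theorem boldExp_add_le {n : ℕ} (hn : 1 ≤ n) :
    boldExp p + (n - 1) / (p - 1) + padicValNat p n ≤ boldExp p * n := by
  have h1 : (p - 1) * padicValNat p n ≤ n - 1 := sub_one_mul_padicValNat_le
  have h2 : (p - 1) * ((n - 1) / (p - 1)) ≤ n - 1 := Nat.mul_div_le _ _
  have hp2 := hp.out.two_le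
  unfold boldExp
  split_ifs with h
  · subst h
    simp only [Nat.add_one_sub_one, one_mul] at h1 h2
    omega
  · have h3 : 2 * padicValNat p n ≤ n - 1 := le_trans (Nat.mul_le_mul_right _ (by omega)) h1
    have h4 : 2 * ((n - 1) / (p - 1)) ≤ n - 1 := le_trans (Nat.mul_le_mul_right _ (by omega)) h2
    omega

/-- It suffices that `2 v + 2 k ≤ n` for `v = v_p(n)`. If `v ≤ k + 3` this follows from `4 k + 6 ≤
n`; otherwise `2 v + 2 k ≤ 4 v ≤ 2^v ≤ n`. -/
theorem add_le_boldExp_mul {n k : ℕ} (hn : 4 * k + 8 ≤ n) :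
    k + (n - 1) / (p - 1) + padicValNat p n ≤ boldExp p * n := by
  have h2 : (p - 1) * ((n - 1) / (p - 1)) ≤ n - 1 := Nat.mul_div_le _ _
  have hp2 := hp.out.two_le
  have h5 : 2 * padicValNat p n + 2 * k ≤ n := by
    set v := padicValNat p n
    have h6 : 2 ^ v ≤ n :=
      le_trans (Nat.pow_le_pow_left hp2 v) (Nat.le_of_dvd (by omega) pow_padicValNat_dvd)
    rcases lt_or_ge v (k + 4) with h | h
    · omega
    · have h7 : ∀ m, 4 * (m + 4) ≤ 2 ^ (m + 4) := by
        intro m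
        induction m with
        | zero => norm_num
        | succ m ih => rw [show m + 1 + 4 = (m + 4) + 1 by omega, pow_succ]; omega
      have h8 := h7 (v - 4)
      rw [Nat.sub_add_cancel (by omega)] at h8
      omega
  unfold boldExp
  split_ifs with h
  · subst h
    simp only [Nat.add_one_sub_one, one_mul] at h2
    omega
  · have h4 : 2 * ((n - 1) / (p - 1)) ≤ n - 1 := le_trans (Nat.mul_le_mul_right _ (by omega)) h2
    omega

/-- The partial sums of the Baker-Campbell-Hausdorff series. -/
noncomputable def bchSum (R : ℕ) (x y : L) : L :=
  ∑ n ∈ Icc 1 R, FreeLieAlgebra.lift ℚ ![x, y] (bchWord n)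

theorem map_lift_pair {L' : Type*} [LieRing L'] [LieAlgebra ℚ L'] (f : L →ₗ⁅ℚ⁆ L') (x y : L)
    (w : LieWord) :
    f (FreeLieAlgebra.lift ℚ ![x, y] w) = FreeLieAlgebra.lift ℚ ![f x, f y] w := by
  have : f.comp (FreeLieAlgebra.lift ℚ ![x, y]) = FreeLieAlgebra.lift ℚ ![f x, f y] := by
    ext1 i
    fin_cases i <;> simp
  exact congrArg (fun F => F w) this

theorem map_bchSum {L' : Type*} [LieRing L'] [LieAlgebra ℚ L'] (f : L →ₗ⁅ℚ⁆ L') (R : ℕ)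
    (x y : L) : f (bchSum R x y) = bchSum R (f x) (f y) := by
  simp only [bchSum, map_sum, map_lift_pair]

theorem IsLieLattice.lift_pair_bchWord_mem (hΛ : IsLieLattice p Λ) {x y : L}
    (hx : x ∈ pPowMul p Λ (boldExp p)) (hy : y ∈ pPowMul p Λ (boldExp p)) (n : ℕ) :
    FreeLieAlgebra.lift ℚ ![x, y] (bchWord n) ∈ pPowMul p Λ (boldExp p) := by
  rcases Nat.eq_zero_or_pos n with hn | hn
  · subst hn; simp [lift_bchWord, zero_mem]
  refine hΛ.lift_bchWord_mem ?_ (boldExp_add_le hn)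
  intro i; fin_cases i
  · exact hx
  · exact hy

theorem IsLieLattice.lift_pair_bchWord_mem_of_le (hΛ : IsLieLattice p Λ) {x y : L}
    (hx : x ∈ pPowMul p Λ (boldExp p)) (hy : y ∈ pPowMul p Λ (boldExp p)) {n k : ℕ}
    (hn : 4 * k + 8 ≤ n) :
    FreeLieAlgebra.lift ℚ ![x, y] (bchWord n) ∈ pPowMul p Λ k := by
  refine hΛ.lift_bchWord_mem ?_ (add_le_boldExp_mul hn)
  intro i; fin_cases i
  · exact hx
  · exact hy

theorem IsLieLattice.bchSum_mem (hΛ : IsLieLattice p Λ) {x y : L}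
    (hx : x ∈ pPowMul p Λ (boldExp p)) (hy : y ∈ pPowMul p Λ (boldExp p)) (R : ℕ) :
    bchSum R x y ∈ pPowMul p Λ (boldExp p) :=
  sum_mem fun n _ => hΛ.lift_pair_bchWord_mem hx hy n

theorem IsLieLattice.bchSum_sub_bchSum_mem (hΛ : IsLieLattice p Λ) {x y : L}
    (hx : x ∈ pPowMul p Λ (boldExp p)) (hy : y ∈ pPowMul p Λ (boldExp p)) {k R R' : ℕ}
    (hR : 4 * k + 8 ≤ R) (hR' : R ≤ R') :
    bchSum R' x y - bchSum R x y ∈ pPowMul p Λ k := by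
  rw [bchSum, bchSum, ← Finset.sum_sdiff (Finset.Icc_subset_Icc_right hR' : Icc 1 R ⊆ Icc 1 R'),
    add_sub_cancel_right]
  refine sum_mem fun n hn => hΛ.lift_pair_bchWord_mem_of_le hx hy ?_
  simp only [mem_sdiff, mem_Icc] at hn
  omega

/-- The lattice of pairs of elements of `Λ` that are congruent modulo `pʲ`. -/
def pairLattice (p : ℕ) (Λ : AddSubgroup L) (j : ℕ) : AddSubgroup (L × L) where
  carrier := {f | f.1 ∈ Λ ∧ f.2 ∈ Λ ∧ f.2 - f.1 ∈ pPowMul p Λ j}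
  zero_mem' := by simp [zero_mem]
  add_mem' {f g} hf hg := ⟨add_mem hf.1 hg.1, add_mem hf.2.1 hg.2.1, by
    rw [Prod.snd_add, Prod.fst_add, add_sub_add_comm]; exact add_mem hf.2.2 hg.2.2⟩
  neg_mem' {f} hf := ⟨neg_mem hf.1, neg_mem hf.2.1, by
    rw [Prod.snd_neg, Prod.fst_neg, neg_sub_neg, ← neg_sub]; exact neg_mem hf.2.2⟩

theorem IsLieLattice.pair (hΛ : IsLieLattice p Λ) (j : ℕ) :
    IsLieLattice p (pairLattice p Λ j) where
  smul_mem {q f} hq hf := ⟨hΛ.smul_mem hq hf.1, hΛ.smul_mem hq hf.2.1, by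
    rw [Prod.smul_snd, Prod.smul_fst, ← smul_sub]
    exact hΛ.smul_mem_pPowMul (mul_le_of_le_one_left (by positivity) hq) hf.2.2⟩
  lie_mem {f g} hf hg := ⟨hΛ.lie_mem hf.1 hg.1, hΛ.lie_mem hf.2.1 hg.2.1, by
    have h : ⁅f, g⁆.2 - ⁅f, g⁆.1 = ⁅f.2 - f.1, g.2⁆ + ⁅f.1, g.2 - g.1⁆ := by
      change ⁅f.2, g.2⁆ - ⁅f.1, g.1⁆ = _
      rw [sub_lie, lie_sub]; abel
    rw [h]
    have h1 := hΛ.lie_mem_pPowMul hf.2.2 (show g.2 ∈ pPowMul p Λ 0 from pPowMul_zero.ge hg.2.1)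
    have h2 := hΛ.lie_mem_pPowMul (show f.1 ∈ pPowMul p Λ 0 from pPowMul_zero.ge hf.1) hg.2.2
    rw [zero_add] at h2
    exact add_mem h1 h2⟩

theorem mem_pPowMul_pairLattice {e j : ℕ} {x x' : L} (hx : x ∈ pPowMul p Λ e)
    (hx' : x' ∈ pPowMul p Λ e) (h : x' - x ∈ pPowMul p Λ (e + j)) :
    (x, x') ∈ pPowMul p (pairLattice p Λ j) e := by
  have hp0 : (p : ℚ) ^ e ≠ 0 := pow_ne_zero _ (by exact_mod_cast hp.out.ne_zero)
  obtain ⟨y, hy, rfl⟩ := mem_pPowMul.1 hx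
  obtain ⟨y', hy', rfl⟩ := mem_pPowMul.1 hx'
  obtain ⟨z, hz, h⟩ := mem_pPowMul.1 h
  refine mem_pPowMul.2 ⟨(y, y'), ⟨hy, hy', mem_pPowMul.2 ⟨z, hz, ?_⟩⟩, rfl⟩
  rw [pow_add, mul_smul, ← smul_sub] at h
  exact smul_right_injective _ hp0 h

/-- Pairs congruent modulo `p^(e+j)` form `p^e` times a Lie lattice in `L × L`, so integrality there
is continuity in `L`. For `k ≤ e` both values already lie in `p^k Λ`. -/
theorem IsLieLattice.bchSum_congr (hΛ : IsLieLattice p Λ) {x y x' y' : L}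
    (hx : x ∈ pPowMul p Λ (boldExp p)) (hy : y ∈ pPowMul p Λ (boldExp p))
    (hx' : x' ∈ pPowMul p Λ (boldExp p)) (hy' : y' ∈ pPowMul p Λ (boldExp p)) {k : ℕ}
    (hxx : x' - x ∈ pPowMul p Λ k) (hyy : y' - y ∈ pPowMul p Λ k) (R : ℕ) :
    bchSum R x' y' - bchSum R x y ∈ pPowMul p Λ k := by
  rcases le_total k (boldExp p) with h | h
  · exact hΛ.pPowMul_anti h (sub_mem (hΛ.bchSum_mem hx' hy' R) (hΛ.bchSum_mem hx hy R))
  obtain ⟨j, rfl⟩ := Nat.exists_eq_add_of_le h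
  have h1 := (hΛ.pair j).bchSum_mem (mem_pPowMul_pairLattice hx hx' hxx)
    (mem_pPowMul_pairLattice hy hy' hyy) R
  obtain ⟨f, hf, hf'⟩ := mem_pPowMul.1 h1
  have h3 : (bchSum R (x, x') (y, y')).2 = _ := map_bchSum (LieHom.snd ℚ L L) R _ _
  have h4 : (bchSum R (x, x') (y, y')).1 = _ := map_bchSum (LieHom.fst ℚ L L) R _ _
  rw [← hf'] at h3 h4
  simp only [LieHom.snd_apply, LieHom.fst_apply, Prod.smul_snd, Prod.smul_fst] at h3 h4
  rw [← h3, ← h4, ← smul_sub]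
  obtain ⟨z, hz, h⟩ := mem_pPowMul.1 hf.2.2
  exact mem_pPowMul.2 ⟨z, hz, by rw [← h, pow_add, mul_smul]⟩

end Lattice

end BCHGroup

/-! ### Commuting elements -/

namespace BCHGroup

attribute [local instance 100] LieRing.ofAssociativeRing

open Finset

section Commuting

variable {L : Type*} [LieRing L] [LieAlgebra ℚ L]

theorem dynkin_wordProd_eq_zero {X : Type*} {a : X → L} (ha : ∀ i j, ⁅a i, a j⁆ = 0) :
    ∀ l : List X, 2 ≤ l.length → dynkin a (wordProd l) = 0
  | [], h => by simp at h
  | [i], h => by simp at h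
  | [i, j], _ => by
    rw [wordProd_cons, dynkin_ι_mul, algebraMapInv_wordProd_cons, wordProd_cons, wordProd_nil,
      mul_one, dynkin_ι, ha, zero_smul, add_zero]
  | i :: j :: k :: l, _ => by
    rw [wordProd_cons, dynkin_ι_mul, algebraMapInv_wordProd_cons,
      dynkin_wordProd_eq_zero ha (j :: k :: l) (by simp), lie_zero, zero_smul, add_zero]

theorem lift_bchWord_eq_zero_of_commute {x y : L} (h : ⁅x, y⁆ = 0) {n : ℕ} (hn : 2 ≤ n) :
    FreeLieAlgebra.lift ℚ ![x, y] (bchWord n) = 0 := by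
  have h' : ⁅y, x⁆ = 0 := by rw [← lie_skew, h, neg_zero]
  have := Nat.fact_prime_two
  have key : ∀ P ∈ weightedWords (Fin 2) 2 n (n - 1), dynkin ![x, y] P = 0 := by
    intro P hP
    induction hP using AddSubgroup.closure_induction with
    | mem P hP =>
      obtain ⟨q, l, hl, -, rfl⟩ := hP
      rw [map_smul, dynkin_wordProd_eq_zero _ l (hl ▸ hn), smul_zero]
      intro i j
      fin_cases i <;> fin_cases j <;> simp [h, h']
    | zero => simp
    | add P Q _ _ h h' => rw [map_add, h, h', add_zero]
    | neg P _ h => rw [map_neg, h, neg_zero]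
  rw [lift_bchWord, key _ (bchComponent_mem_weightedWords n), smul_zero]

theorem bchComponent_one : bchComponent 1 = var 0 + var 1 := by
  simp [bchComponent, logComponent, PowerSeries.coeff_mul, expSeries,
    Finset.Nat.antidiagonal_succ, PowerSeries.coeff_one, add_comm]

theorem bchSum_of_commute {x y : L} (h : ⁅x, y⁆ = 0) {R : ℕ} (hR : 1 ≤ R) :
    bchSum R x y = x + y := by
  rw [bchSum, Finset.sum_eq_single 1]
  · rw [lift_bchWord, bchComponent_one, map_add, var, var, dynkin_ι, dynkin_ι]
    simp
  · intro n hn hn1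
    exact lift_bchWord_eq_zero_of_commute h (by have := (mem_Icc.1 hn).1; omega)
  · intro h1
    exact absurd (mem_Icc.2 ⟨le_rfl, hR⟩) h1

end Commuting

/-! ### Associativity, formally and up to a power of `p` -/

section Truncated

variable {B : Type*} [Ring B] [Algebra ℚ B] {τ : B}

theorem lift_pair_toAssoc (a b : B) (w : LieWord) :
    FreeLieAlgebra.lift ℚ ![a, b] w = FreeAlgebra.lift ℚ ![a, b] w.toAssoc := by
  have : FreeLieAlgebra.lift ℚ ![a, b] =
      ((FreeAlgebra.lift ℚ ![a, b] : Assoc2 →ₐ[ℚ] B) : Assoc2 →ₗ⁅ℚ⁆ B).comp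
        (FreeLieAlgebra.lift ℚ var) := by
    ext1 i
    simp [var]
  exact congrArg (fun F => F w) this

theorem lift_smul_of_mem_weightedWords (hc : ∀ b, Commute τ b) {X : Type*} (a : X → B)
    {p n m : ℕ} {P : FreeAlgebra ℚ X} (hP : P ∈ weightedWords X p n m) :
    FreeAlgebra.lift ℚ (fun i => τ * a i) P = τ ^ n * FreeAlgebra.lift ℚ a P := by
  induction hP using AddSubgroup.closure_induction with
  | mem P hP =>
    obtain ⟨q, l, hl, -, rfl⟩ := hP
    rw [map_smul, map_smul, mul_smul_comm]
    congr 1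
    subst hl
    induction l with
    | nil => simp
    | cons i l ih =>
      rw [wordProd_cons, map_mul, map_mul, ih, FreeAlgebra.lift_ι_apply, FreeAlgebra.lift_ι_apply,
        List.length_cons, pow_succ', mul_assoc, mul_assoc, ← mul_assoc (a i),
        ← ((hc (a i)).pow_left _).eq, mul_assoc]
  | zero => simp
  | add P Q _ _ h h' => rw [map_add, map_add, h, h', mul_add]
  | neg P _ h => rw [map_neg, map_neg, h, mul_neg]

theorem bchSum_central_mul (hc : ∀ b, Commute τ b) (R : ℕ) (a b : B) :
    bchSum R (τ * a) (τ * b) =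
      ∑ n ∈ Icc 1 R, τ ^ n * FreeAlgebra.lift ℚ ![a, b] (bchComponent n) := by
  have := Nat.fact_prime_two
  rw [bchSum]
  refine Finset.sum_congr rfl fun n _ => ?_
  rw [lift_pair_toAssoc, toAssoc_bchWord,
    ← lift_smul_of_mem_weightedWords hc _ (bchComponent_mem_weightedWords (p := 2) n)]
  congr 2
  ext i
  fin_cases i <;> rfl

theorem exists_bchSum_eq_central_mul (hc : ∀ b, Commute τ b) (R : ℕ) (a b : B) :
    ∃ c, bchSum R (τ * a) (τ * b) = τ * c := by
  rw [bchSum_central_mul hc]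
  refine ⟨∑ n ∈ Icc 1 R, τ ^ (n - 1) * FreeAlgebra.lift ℚ ![a, b] (bchComponent n), ?_⟩
  rw [Finset.mul_sum]
  refine Finset.sum_congr rfl fun n hn => ?_
  rw [← mul_assoc, ← pow_succ', Nat.sub_add_cancel (mem_Icc.1 hn).1]

theorem exp_bchSum (hc : ∀ b, Commute τ b) {R : ℕ} (hτ : τ ^ (R + 1) = 0) (a b : B) :
    IsNilpotent.exp (bchSum R (τ * a) (τ * b)) =
      IsNilpotent.exp (τ * a) * IsNilpotent.exp (τ * b) := by
  rw [bchSum_central_mul hc, exp_sum_bchComponent _ hc hτ]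
  simp [var]

/-- Both sides have exponential `exp (τ a) exp (τ b) exp (τ c)` and are multiples of `τ`, where
`exp` is injective. -/
theorem bchSum_assoc_of_central (hc : ∀ b, Commute τ b) {R : ℕ} (hτ : τ ^ (R + 1) = 0)
    (a b c : B) : bchSum R (bchSum R (τ * a) (τ * b)) (τ * c) =
      bchSum R (τ * a) (bchSum R (τ * b) (τ * c)) := by
  obtain ⟨d, hd⟩ := exists_bchSum_eq_central_mul hc R a b
  obtain ⟨e, he⟩ := exists_bchSum_eq_central_mul hc R b c
  have h1 := exp_bchSum hc hτ d c
  have h2 := exp_bchSum hc hτ a e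
  rw [← hd, exp_bchSum hc hτ, hd] at h1
  rw [← he, exp_bchSum hc hτ, he, ← mul_assoc, ← h1] at h2
  rw [hd, he]
  obtain ⟨f, hf⟩ := exists_bchSum_eq_central_mul hc R d c
  obtain ⟨g, hg⟩ := exists_bchSum_eq_central_mul hc R a e
  rw [hf, hg] at h2 ⊢
  exact (exp_injective_of_central hc hτ h2).symm

end Truncated

section Associativity

open Polynomial

variable {L : Type*} [LieRing L] [LieAlgebra ℚ L]

theorem coeff_gradeHom_bchSum_assoc {N R : ℕ} (hN : N ≤ R) {ι : Type*} (x y z : ι) :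
    (gradeHom (FreeLieAlgebra.lift ℚ (FreeAlgebra.ι ℚ)
      (bchSum R (bchSum R (FreeLieAlgebra.of ℚ x) (FreeLieAlgebra.of ℚ y)) (FreeLieAlgebra.of ℚ z) -
        bchSum R (FreeLieAlgebra.of ℚ x)
          (bchSum R (FreeLieAlgebra.of ℚ y) (FreeLieAlgebra.of ℚ z))))).coeff N = 0 := by
  let f : FreeLieAlgebra ℚ ι →ₗ⁅ℚ⁆ TruncPoly (FreeAlgebra ℚ ι) R :=
    (((truncMk (FreeAlgebra ℚ ι) R).comp gradeHom : FreeAlgebra ℚ ι →ₐ[ℚ] _) :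
      FreeAlgebra ℚ ι →ₗ⁅ℚ⁆ _).comp (FreeLieAlgebra.lift ℚ (FreeAlgebra.ι ℚ))
  have hf : ∀ i, f (FreeLieAlgebra.of ℚ i) =
      truncMk _ R X * truncMk _ R (C (FreeAlgebra.ι ℚ i)) := by
    intro i
    change truncMk _ R (gradeHom (FreeLieAlgebra.lift ℚ (FreeAlgebra.ι ℚ) _)) = _
    rw [FreeLieAlgebra.lift_of_apply, gradeHom, FreeAlgebra.lift_ι_apply, ← map_mul, X_mul_C,
      C_mul_X_eq_monomial]
  rw [← Polynomial.coeff_zero N]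
  refine coeff_eq_of_truncMk_eq (R := R) ?_ hN
  change f _ = _
  rw [map_sub, map_bchSum, map_bchSum, map_bchSum, map_bchSum, hf, hf, hf,
    bchSum_assoc_of_central truncMk_X_commute truncMk_X_pow, sub_self, map_zero]

theorem coeffPoly_bchSum_assoc {N R : ℕ} (hN : N ≤ R) (x y z : L) :
    coeffPoly N (bchSum R (bchSum R ((X : ℚ[X]) ⊗ₜ[ℚ] x) (X ⊗ₜ[ℚ] y)) (X ⊗ₜ[ℚ] z)) =
      coeffPoly N (bchSum R ((X : ℚ[X]) ⊗ₜ[ℚ] x) (bchSum R (X ⊗ₜ[ℚ] y) (X ⊗ₜ[ℚ] z))) := by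
  have h := coeffPoly_lift_scaled_eq_zero ![x, y, z]
    (coeff_gradeHom_bchSum_assoc hN (0 : Fin 3) 1 2)
  rw [map_sub, map_bchSum, map_bchSum, map_bchSum, map_bchSum, map_sub, sub_eq_zero] at h
  simpa [scaled] using h

variable {p : ℕ} {Λ : AddSubgroup L}

/-- The lattice `Λ[t]` in `L[t]`. -/
noncomputable def polyLattice (Λ : AddSubgroup L) : AddSubgroup (ℚ[X] ⊗[ℚ] L) where
  carrier := {P | ∀ N, coeffPoly N P ∈ Λ}
  zero_mem' N := by rw [map_zero]; exact zero_mem _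
  add_mem' hP hQ N := by rw [map_add]; exact add_mem (hP N) (hQ N)
  neg_mem' hP N := by rw [map_neg]; exact neg_mem (hP N)

theorem IsLieLattice.poly (hΛ : IsLieLattice p Λ) : IsLieLattice p (polyLattice Λ) where
  smul_mem hq hP N := by rw [map_smul]; exact hΛ.smul_mem hq (hP N)
  lie_mem hP hQ N := by
    change coeffPoly N (LieRing.toBracket.bracket _ _) ∈ _
    rw [coeffPoly_lie]
    exact sum_mem fun x _ => hΛ.lie_mem (hP x.1) (hQ x.2)

theorem coeffPoly_mem_pPowMul {k : ℕ} {P : ℚ[X] ⊗[ℚ] L} (hP : P ∈ pPowMul p (polyLattice Λ) k)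
    (N : ℕ) : coeffPoly N P ∈ pPowMul p Λ k := by
  obtain ⟨Q, hQ, rfl⟩ := mem_pPowMul.1 hP
  exact mem_pPowMul.2 ⟨_, hQ N, (map_smul _ _ _).symm⟩

theorem X_tmul_mem_pPowMul {k : ℕ} {x : L} (hx : x ∈ pPowMul p Λ k) :
    (X : ℚ[X]) ⊗ₜ[ℚ] x ∈ pPowMul p (polyLattice Λ) k := by
  obtain ⟨y, hy, rfl⟩ := mem_pPowMul.1 hx
  refine mem_pPowMul.2 ⟨X ⊗ₜ[ℚ] y, fun N => ?_, by rw [TensorProduct.tmul_smul]⟩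
  rw [coeffPoly_tmul, Polynomial.coeff_X]
  split_ifs
  · rwa [one_smul]
  · rw [zero_smul]; exact zero_mem _

/-- Partial sums are associative only in degrees up to the cutoff. For the coefficient of `t^N`,
raising the cutoff from `R` to `max R N` changes both sides by elements of `p^k Λ[t]` and makes that
coefficient of the discrepancy vanish. So every coefficient lies in `p^k Λ`, and so does their
finite sum, the value at `t = 1`. -/
theorem IsLieLattice.bchSum_assoc_mem [Fact p.Prime] (hΛ : IsLieLattice p Λ) {x y z : L}
    (hx : x ∈ pPowMul p Λ (boldExp p)) (hy : y ∈ pPowMul p Λ (boldExp p))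
    (hz : z ∈ pPowMul p Λ (boldExp p)) {k R : ℕ} (hR : 4 * k + 8 ≤ R) :
    bchSum R (bchSum R x y) z - bchSum R x (bchSum R y z) ∈ pPowMul p Λ k := by
  have hx' := X_tmul_mem_pPowMul hx
  have hy' := X_tmul_mem_pPowMul hy
  have hz' := X_tmul_mem_pPowMul hz
  set x' := (X : ℚ[X]) ⊗ₜ[ℚ] x with hxd
  set y' := (X : ℚ[X]) ⊗ₜ[ℚ] y with hyd
  set z' := (X : ℚ[X]) ⊗ₜ[ℚ] z with hzd
  have hP := hΛ.poly
  have h1 : ∀ R' ≥ R, bchSum R' (bchSum R' x' y') z' - bchSum R (bchSum R x' y') z' ∈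
      pPowMul p (polyLattice Λ) k := by
    intro R' hR'
    have e1 := hP.bchSum_congr (hP.bchSum_mem hx' hy' R) hz' (hP.bchSum_mem hx' hy' R') hz'
      (hP.bchSum_sub_bchSum_mem hx' hy' hR hR') (by rw [sub_self]; exact zero_mem _) R'
    have e2 := hP.bchSum_sub_bchSum_mem (hP.bchSum_mem hx' hy' R) hz' hR hR'
    rw [← sub_add_sub_cancel]
    exact add_mem e1 e2
  have h2 : ∀ R' ≥ R, bchSum R' x' (bchSum R' y' z') - bchSum R x' (bchSum R y' z') ∈
      pPowMul p (polyLattice Λ) k := by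
    intro R' hR'
    have e1 := hP.bchSum_congr hx' (hP.bchSum_mem hy' hz' R) hx' (hP.bchSum_mem hy' hz' R')
      (by rw [sub_self]; exact zero_mem _) (hP.bchSum_sub_bchSum_mem hy' hz' hR hR') R'
    have e2 := hP.bchSum_sub_bchSum_mem hx' (hP.bchSum_mem hy' hz' R) hR hR'
    rw [← sub_add_sub_cancel]
    exact add_mem e1 e2
  have h3 : ∀ N, coeffPoly N (bchSum R (bchSum R x' y') z' - bchSum R x' (bchSum R y' z')) ∈
      pPowMul p Λ k := by
    intro N
    have e1 := coeffPoly_mem_pPowMul (h1 (max R N) (le_max_left _ _)) N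
    have e2 := coeffPoly_mem_pPowMul (h2 (max R N) (le_max_left _ _)) N
    have e3 := coeffPoly_bchSum_assoc (le_max_right R N) x y z
    rw [map_sub] at e1 e2 ⊢
    rw [← hxd, ← hyd, ← hzd] at e3
    rw [e3] at e1
    have e4 := sub_mem e2 e1
    rwa [sub_sub_sub_cancel_left] at e4
  have h4 : ∀ w : L, evalPoly ((X : ℚ[X]) ⊗ₜ[ℚ] w) = w := by intro w; simp
  obtain ⟨d, hd⟩ := exists_evalPoly_eq_sum
    (bchSum R (bchSum R x' y') z' - bchSum R x' (bchSum R y' z'))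
  have h5 := hd d le_rfl
  rw [map_sub, map_bchSum, map_bchSum, map_bchSum, map_bchSum, hxd, hyd, hzd, h4, h4, h4] at h5
  rw [h5]
  exact sum_mem fun N _ => h3 N

end Associativity

end BCHGroup

/-! ### The lattice `M` in `ℚ ⊗ M` and the group `𝐩 M` -/

namespace BCHGroup

open Finset

section Rationalization

variable {p : ℕ} [hp : Fact p.Prime] {M : Type*} [LieRing M] [LieAlgebra ℤ_[p] M]

theorem one_tmul_injective [Module.IsTorsionFree ℤ_[p] M] :
    Function.Injective (fun m : M => (1 : ℚ) ⊗ₜ[ℤ] m) := by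
  have htf : Module.IsTorsionFree ℤ M := by
    refine Module.IsTorsionFree.mk fun r hr x y hxy => ?_
    have hr0 : r ≠ 0 := hr.ne_zero
    have h1 : (r : ℤ_[p]) ≠ 0 := by exact_mod_cast hr0
    refine smul_right_injective M h1 ?_
    simpa [Int.cast_smul_eq_zsmul] using hxy
  have h : Function.Injective ((Algebra.linearMap ℤ ℚ).rTensor M) :=
    Module.Flat.rTensor_preserves_injective_linearMap _ (by
      intro a b hab
      simpa using hab)
  intro x y hxy
  apply (TensorProduct.lid ℤ M).symm.injective
  apply h
  simpa using hxy

variable (M) in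
/-- The image of `M` in `ℚ ⊗ M`. -/
def integralLattice : AddSubgroup (ℚ ⊗[ℤ] M) :=
  (TensorProduct.mk ℤ ℚ M 1).toAddMonoidHom.range

theorem mem_integralLattice {x : ℚ ⊗[ℤ] M} :
    x ∈ integralLattice M ↔ ∃ m : M, (1 : ℚ) ⊗ₜ[ℤ] m = x := Iff.rfl

theorem isLieLattice_integralLattice : IsLieLattice p (integralLattice M) where
  smul_mem {q x} hq hx := by
    obtain ⟨m, rfl⟩ := mem_integralLattice.1 hx
    let c : ℤ_[p] := ⟨(q : ℚ_[p]), by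
      rw [Padic.eq_padicNorm]; exact_mod_cast hq⟩
    have hc : (q.den : ℤ_[p]) * c = (q.num : ℤ_[p]) := by
      apply Subtype.ext
      change (((q.den : ℤ_[p]) : ℚ_[p])) * (q : ℚ_[p]) = ((q.num : ℤ_[p]) : ℚ_[p])
      rw [PadicInt.coe_natCast, PadicInt.coe_intCast]
      exact_mod_cast congrArg (fun r : ℚ => (r : ℚ_[p])) (Rat.den_mul_eq_num q)
    refine mem_integralLattice.2 ⟨c • m, ?_⟩
    -- Only integers move across `⊗[ℤ]`, so `q • (1 ⊗ m) = 1 ⊗ c • m` is verified after multiplying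
    -- by the denominator of `q`.
    have hd : (q.den : ℚ) ≠ 0 := by exact_mod_cast q.den_nz
    apply smul_right_injective _ hd
    simp only
    rw [smul_smul, Rat.den_mul_eq_num, TensorProduct.smul_tmul', TensorProduct.smul_tmul',
      smul_eq_mul, smul_eq_mul, mul_one, mul_one]
    have e1 : (q.den : ℚ) = (q.den : ℤ) • (1 : ℚ) := by simp
    have e2 : (q.num : ℚ) = q.num • (1 : ℚ) := by simp
    rw [e1, e2, TensorProduct.smul_tmul, TensorProduct.smul_tmul, natCast_zsmul,
      ← Nat.cast_smul_eq_nsmul ℤ_[p], smul_smul, hc, Int.cast_smul_eq_zsmul]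
  lie_mem {x y} hx hy := by
    obtain ⟨m, rfl⟩ := mem_integralLattice.1 hx
    obtain ⟨n, rfl⟩ := mem_integralLattice.1 hy
    exact mem_integralLattice.2 ⟨⁅m, n⁆, by
      rw [LieAlgebra.ExtendScalars.bracket_tmul, mul_one]⟩

theorem pow_smul_one_tmul (k : ℕ) (m : M) :
    (p : ℚ) ^ k • ((1 : ℚ) ⊗ₜ[ℤ] m) = (1 : ℚ) ⊗ₜ[ℤ] ((p : ℤ_[p]) ^ k • m) := by
  rw [TensorProduct.smul_tmul', smul_eq_mul, mul_one]
  have e1 : (p : ℚ) ^ k = ((p ^ k : ℕ) : ℤ) • (1 : ℚ) := by simp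
  rw [e1, TensorProduct.smul_tmul, natCast_zsmul, ← Nat.cast_smul_eq_nsmul ℤ_[p], Nat.cast_pow]

theorem tendsto_padicTopology {f : ℕ → M} {x : M}
    (h : ∀ k, ∀ᶠ n in Filter.atTop,
      f n - x ∈ ((Ideal.span {(p : ℤ_[p])}) ^ k • ⊤ : Submodule ℤ_[p] M)) :
    Filter.Tendsto f Filter.atTop (@nhds M (padicTopology p M) x) := by
  have hb := AddGroupFilterBasis.nhds_hasBasis
    (@ModuleFilterBasis.toAddGroupFilterBasis ℤ_[p] M _ (Ideal.span {(p : ℤ_[p])}).adicTopology _ _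
      ((Ideal.span {(p : ℤ_[p])}).ringFilterBasis.moduleFilterBasis
        ((Ideal.span {(p : ℤ_[p])}).adic_module_basis M))) x
  refine hb.tendsto_right_iff.2 ?_
  rintro V ⟨k, rfl⟩
  filter_upwards [h k] with n hn
  exact ⟨f n - x, hn, add_sub_cancel _ _⟩

variable [Module.IsTorsionFree ℤ_[p] M]

theorem one_tmul_mem_pPowMul_iff {k : ℕ} {m : M} :
    (1 : ℚ) ⊗ₜ[ℤ] m ∈ pPowMul p (integralLattice M) k ↔
      m ∈ ((Ideal.span {(p : ℤ_[p])}) ^ k • ⊤ : Submodule ℤ_[p] M) := by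
  rw [Ideal.span_singleton_pow, Submodule.ideal_span_singleton_smul,
    Submodule.mem_smul_pointwise_iff_exists, mem_pPowMul]
  constructor
  · rintro ⟨y, ⟨n, rfl⟩, h⟩
    refine ⟨n, trivial, one_tmul_injective (p := p) ?_⟩
    exact (pow_smul_one_tmul k n).symm.trans h
  · rintro ⟨n, -, rfl⟩
    exact ⟨_, ⟨n, rfl⟩, pow_smul_one_tmul k n⟩

theorem one_tmul_mem_pPowMul_boldExp_iff {m : M} :
    (1 : ℚ) ⊗ₜ[ℤ] m ∈ pPowMul p (integralLattice M) (boldExp p) ↔ m ∈ boldPMul p M := by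
  rw [one_tmul_mem_pPowMul_iff, Ideal.span_singleton_pow, Submodule.ideal_span_singleton_smul,
    boldPMul, boldP_eq_pow, Nat.cast_pow]

/-- The components of the Baker-Campbell-Hausdorff series have values in `𝐩 M`. -/
theorem exists_value_bchWord (n : ℕ) (a b : boldPMul p M) :
    ∃ c : boldPMul p M, (bchWord n).value (a : M) (b : M) = (1 : ℚ) ⊗ₜ[ℤ] (c : M) := by
  have h := isLieLattice_integralLattice.lift_pair_bchWord_mem
    (one_tmul_mem_pPowMul_boldExp_iff.2 a.2) (one_tmul_mem_pPowMul_boldExp_iff.2 b.2) n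
  obtain ⟨c, hc⟩ := mem_integralLattice.1
    (pPowMul_zero.le (isLieLattice_integralLattice.pPowMul_anti (Nat.zero_le _) h))
  refine ⟨⟨c, ?_⟩, hc.symm⟩
  rw [← hc] at h
  exact one_tmul_mem_pPowMul_boldExp_iff.1 h

variable (p M) in
/-- The value `Hₙ(a, b)`, as an element of `𝐩 M`. -/
noncomputable def bchValue (n : ℕ) (a b : boldPMul p M) : boldPMul p M :=
  (exists_value_bchWord n a b).choose

theorem value_bchWord (n : ℕ) (a b : boldPMul p M) :
    (bchWord n).value (a : M) (b : M) = (1 : ℚ) ⊗ₜ[ℤ] (bchValue p M n a b : M) :=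
  (exists_value_bchWord n a b).choose_spec

theorem one_tmul_sum_bchValue (R : ℕ) (a b : boldPMul p M) :
    (1 : ℚ) ⊗ₜ[ℤ] (∑ n ∈ Icc 1 R, (bchValue p M n a b : M)) =
      bchSum R ((1 : ℚ) ⊗ₜ[ℤ] (a : M)) ((1 : ℚ) ⊗ₜ[ℤ] (b : M)) := by
  rw [TensorProduct.tmul_sum, bchSum]
  exact Finset.sum_congr rfl fun n _ => (value_bchWord n a b).symm

theorem bchValue_mem {n k : ℕ} (hn : 4 * k + 8 ≤ n) (a b : boldPMul p M) :
    (bchValue p M n a b : M) ∈ ((Ideal.span {(p : ℤ_[p])}) ^ k • ⊤ : Submodule ℤ_[p] M) := by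
  rw [← one_tmul_mem_pPowMul_iff, ← value_bchWord]
  exact isLieLattice_integralLattice.lift_pair_bchWord_mem_of_le
    (one_tmul_mem_pPowMul_boldExp_iff.2 a.2) (one_tmul_mem_pPowMul_boldExp_iff.2 b.2) hn

theorem sum_bchValue_sub_mem {k R R' : ℕ} (hR : 4 * k + 8 ≤ R) (hR' : R ≤ R')
    (a b : boldPMul p M) :
    (∑ n ∈ Icc 1 R', (bchValue p M n a b : M)) - ∑ n ∈ Icc 1 R, (bchValue p M n a b : M) ∈
      ((Ideal.span {(p : ℤ_[p])}) ^ k • ⊤ : Submodule ℤ_[p] M) := by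
  rw [← one_tmul_mem_pPowMul_iff, TensorProduct.tmul_sub, one_tmul_sum_bchValue,
    one_tmul_sum_bchValue]
  exact isLieLattice_integralLattice.bchSum_sub_bchSum_mem
    (one_tmul_mem_pPowMul_boldExp_iff.2 a.2) (one_tmul_mem_pPowMul_boldExp_iff.2 b.2) hR hR'

variable [IsAdicComplete (Ideal.span {(p : ℤ_[p])}) M]

theorem exists_bchLimit (a b : boldPMul p M) :
    ∃ c : boldPMul p M, ∀ k R, 4 * k + 8 ≤ R →
      (∑ n ∈ Icc 1 R, (bchValue p M n a b : M)) - (c : M) ∈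
        ((Ideal.span {(p : ℤ_[p])}) ^ k • ⊤ : Submodule ℤ_[p] M) := by
  -- Completeness asks for a sequence whose terms from the `k`-th on agree modulo `p^k`; the partial
  -- sums up to `4 k + 8` have this rate.
  obtain ⟨c, hc⟩ := IsPrecomplete.prec' (I := Ideal.span {(p : ℤ_[p])}) (M := M)
    (fun k => ∑ n ∈ Icc 1 (4 * k + 8), (bchValue p M n a b : M)) (by
      intro i j hij
      rw [SModEq.sub_mem, ← neg_sub]
      exact neg_mem (sum_bchValue_sub_mem le_rfl (by omega) a b))
  have hc' : ∀ k R, 4 * k + 8 ≤ R → (∑ n ∈ Icc 1 R, (bchValue p M n a b : M)) - c ∈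
      ((Ideal.span {(p : ℤ_[p])}) ^ k • ⊤ : Submodule ℤ_[p] M) := by
    intro k R hR
    rw [← sub_add_sub_cancel]
    exact add_mem (sum_bchValue_sub_mem le_rfl hR a b) (SModEq.sub_mem.1 (hc k))
  refine ⟨⟨c, ?_⟩, hc'⟩
  -- The limit is congruent modulo `𝐩 M` to a partial sum, which lies in `𝐩 M`.
  have h1 : (∑ n ∈ Icc 1 (4 * boldExp p + 8), (bchValue p M n a b : M)) ∈ boldPMul p M :=
    sum_mem fun n _ => (bchValue p M n a b).2
  have h2 := hc' (boldExp p) _ le_rfl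
  rw [← one_tmul_mem_pPowMul_iff, one_tmul_mem_pPowMul_boldExp_iff] at h2
  have h3 := sub_mem h1 h2
  rwa [sub_sub_cancel] at h3

variable (p M) in
/-- The sum `H(a, b)` of the Baker-Campbell-Hausdorff series in `𝐩 M`. -/
noncomputable def bchLimit (a b : boldPMul p M) : boldPMul p M := (exists_bchLimit a b).choose

theorem sum_sub_bchLimit_mem (a b : boldPMul p M) {k R : ℕ} (hR : 4 * k + 8 ≤ R) :
    (∑ n ∈ Icc 1 R, (bchValue p M n a b : M)) - (bchLimit p M a b : M) ∈
      ((Ideal.span {(p : ℤ_[p])}) ^ k • ⊤ : Submodule ℤ_[p] M) :=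
  (exists_bchLimit a b).choose_spec k R hR

theorem bchSum_sub_bchLimit_mem (a b : boldPMul p M) {k R : ℕ} (hR : 4 * k + 8 ≤ R) :
    bchSum R ((1 : ℚ) ⊗ₜ[ℤ] (a : M)) ((1 : ℚ) ⊗ₜ[ℤ] (b : M)) -
      (1 : ℚ) ⊗ₜ[ℤ] (bchLimit p M a b : M) ∈ pPowMul p (integralLattice M) k := by
  rw [← one_tmul_sum_bchValue, ← TensorProduct.tmul_sub, one_tmul_mem_pPowMul_iff]
  exact sum_sub_bchLimit_mem a b hR

theorem eq_of_sub_mem_pPowMul {a b : boldPMul p M}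
    (h : ∀ k, (1 : ℚ) ⊗ₜ[ℤ] (a : M) - (1 : ℚ) ⊗ₜ[ℤ] (b : M) ∈ pPowMul p (integralLattice M) k) :
    a = b := by
  apply Subtype.ext
  rw [← sub_eq_zero]
  refine IsHausdorff.haus' (I := Ideal.span {(p : ℤ_[p])}) _ fun k => ?_
  rw [SModEq.sub_mem, sub_zero, ← one_tmul_mem_pPowMul_iff, TensorProduct.tmul_sub]
  exact h k

theorem bchLimit_assoc (a b c : boldPMul p M) :
    bchLimit p M (bchLimit p M a b) c = bchLimit p M a (bchLimit p M b c) := by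
  refine eq_of_sub_mem_pPowMul fun k => ?_
  have hΛ : IsLieLattice p (integralLattice M) := isLieLattice_integralLattice
  have hm : ∀ d : boldPMul p M, (1 : ℚ) ⊗ₜ[ℤ] (d : M) ∈
      pPowMul p (integralLattice M) (boldExp p) := fun d => one_tmul_mem_pPowMul_boldExp_iff.2 d.2
  have h0 : ∀ d : boldPMul p M, (1 : ℚ) ⊗ₜ[ℤ] (d : M) - (1 : ℚ) ⊗ₜ[ℤ] (d : M) ∈
      pPowMul p (integralLattice M) k := fun d => by rw [sub_self]; exact zero_mem _
  set R := 4 * k + 8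
  have h1 := bchSum_sub_bchLimit_mem (bchLimit p M a b) c (le_refl R)
  have h2 := bchSum_sub_bchLimit_mem a (bchLimit p M b c) (le_refl R)
  have h3 := hΛ.bchSum_congr (hm _) (hm c) (hΛ.bchSum_mem (hm a) (hm b) R) (hm c)
    (bchSum_sub_bchLimit_mem a b (le_refl R)) (h0 c) R
  have h4 := hΛ.bchSum_congr (hm a) (hm _) (hm a) (hΛ.bchSum_mem (hm b) (hm c) R) (h0 a)
    (bchSum_sub_bchLimit_mem b c (le_refl R)) R
  have h5 := hΛ.bchSum_assoc_mem (hm a) (hm b) (hm c) (le_refl R)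
  -- Inner and outer limits are replaced by partial sums modulo `p^k` on each side, and `h5`
  -- compares the two results.
  have h6 := add_mem (sub_mem (sub_mem h5 h3) h1) (add_mem h4 h2)
  convert h6 using 1
  abel

theorem bchLimit_of_commute {a b : boldPMul p M} (h : ⁅(a : M), (b : M)⁆ = 0) :
    bchLimit p M a b = a + b := by
  refine (eq_of_sub_mem_pPowMul fun k => ?_).symm
  have h1 := bchSum_sub_bchLimit_mem a b (le_refl (4 * k + 8))
  rw [bchSum_of_commute _ (by omega)] at h1
  · rwa [Submodule.coe_add, TensorProduct.tmul_add]
  · rw [LieAlgebra.ExtendScalars.bracket_tmul, h, TensorProduct.tmul_zero]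

variable (p M) in
/-- The group structure on `𝐩 M` given by the Baker-Campbell-Hausdorff series. -/
@[reducible]
noncomputable def bchGroup : Group (boldPMul p M) :=
  letI : Mul (boldPMul p M) := ⟨bchLimit p M⟩
  letI : One (boldPMul p M) := ⟨0⟩
  letI : Inv (boldPMul p M) := ⟨fun a => -a⟩
  Group.ofLeftAxioms bchLimit_assoc
    (fun a => (bchLimit_of_commute (a := 0) (b := a) (by simp)).trans (zero_add a))
    (fun a => (bchLimit_of_commute (a := -a) (b := a) (by simp)).trans (neg_add_cancel a))

end Rationalization

end BCHGroup

/-- For each `n` there is exactly one Lie word `W n` that equals `Hₙ`. For all `a`, `b` in `𝐩 M`, its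
value `Hₙ(a, b)` is an element `h n a b` of `𝐩 M`, the sequence `Hₙ(a, b)` converges to `0`, the
series `∑ Hₙ(a, b)` converges to an element `H a b` of `𝐩 M`, and `H` is a group operation. -/
theorem mainTheorem9 (p : ℕ) [Fact p.Prime] (M : Type*) [LieRing M] [LieAlgebra ℤ_[p] M]
    [Module.IsTorsionFree ℤ_[p] M] [IsAdicComplete (Ideal.span {(p : ℤ_[p])}) M] :
    ∃ (W : ℕ → BCHGroup.LieWord)
      (h : ℕ → BCHGroup.boldPMul p M → BCHGroup.boldPMul p M → BCHGroup.boldPMul p M)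
      (H : BCHGroup.boldPMul p M → BCHGroup.boldPMul p M → BCHGroup.boldPMul p M),
      (∀ (n : ℕ) (w : BCHGroup.LieWord), w.toAssoc = BCHGroup.bchComponent n ↔ w = W n) ∧
      (∀ (n : ℕ) (a b : BCHGroup.boldPMul p M),
        (W n).value (a : M) (b : M) = (1 : ℚ) ⊗ₜ[ℤ] (h n a b : M)) ∧
      (∀ a b : BCHGroup.boldPMul p M,
        Filter.Tendsto (fun n : ℕ => (h n a b : M)) Filter.atTop
          (@nhds M (BCHGroup.padicTopology p M) 0)) ∧
      (∀ a b : BCHGroup.boldPMul p M,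
        Filter.Tendsto (fun N : ℕ => ∑ n ∈ Finset.Icc 1 N, (h n a b : M)) Filter.atTop
          (@nhds M (BCHGroup.padicTopology p M) (H a b : M))) ∧
      ∃ G : Group (BCHGroup.boldPMul p M),
        ∀ a b : BCHGroup.boldPMul p M, G.mul a b = H a b := by
  refine ⟨BCHGroup.bchWord, BCHGroup.bchValue p M, BCHGroup.bchLimit p M,
    BCHGroup.toAssoc_eq_bchComponent_iff, BCHGroup.value_bchWord, fun a b => ?_, fun a b => ?_,
    BCHGroup.bchGroup p M, fun a b => rfl⟩
  · refine BCHGroup.tendsto_padicTopology fun k => ?_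
    filter_upwards [Filter.eventually_ge_atTop (4 * k + 8)] with n hn
    rw [sub_zero]
    exact BCHGroup.bchValue_mem hn a b
  · refine BCHGroup.tendsto_padicTopology fun k => ?_
    filter_upwards [Filter.eventually_ge_atTop (4 * k + 8)] with R hR
    exact BCHGroup.sum_sub_bchLimit_mem a b hR
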